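/- Let $A,N_1,\dots,N_m\in\mathbb R^{n\times n}$, $X_0\in\mathbb R^{n\times q}$, $C\in\mathbb R^{p\times n}$ and let $\gamma>0$ be such that $$\sigma\Big(A\otimes I+I\otimes A+\tfrac1{\gamma^2}\sum_{k=1}^m N_k\otimes N_k\Big)\subset\{z\in\mathbb C:\operatorname{Re} z<0\}.$$ Define the Gramians $P_0=\int_0^\infty Z(t)\,dt$ and $Q=\int_0^\infty Z^*(t)\,dt$, where $\dot Z=AZ+ZA^\top+\frac1{\gamma^2}\sum_k N_kZN_k^\top$, $Z(0)=X_0X_0^\top$, and $\dot Z^*=A^\top Z^*+Z^*A+\frac1{\gamma^2}\sum_k N_k^\top Z^*N_k$, $Z^*(0)=C^\top C$. Let $n=r+s$ and let $\mathcal S\in\mathbb R^{n\times n}$ be an invertible matrix with $$\mathcal SP_0\mathcal S^\top=\mathcal S^{-\top}Q\mathcal S^{-1}=\begin{pmatrix}\Theta_1&\\&\Theta_2\end{pmatrix},\qquad \Theta_1\in\mathbb R^{r\times r},\ \Theta_2\in\mathbb R^{s\times s}\ \text{diagonal},\quad \Theta_1>0.$$ Partition accordingly $$\mathcal A:=\mathcal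 SA\mathcal S^{-1}=\begin{pmatrix}\mathcal A_{11}&\mathcal A_{12}\\\mathcal A_{21}&\mathcal A_{22}\end{pmatrix},\quad \mathcal N_k:=\mathcal SN_k\mathcal S^{-1}=\begin{pmatrix}\mathcal N_{k,11}&\mathcal N_{k,12}\\\mathcal N_{k,21}&\mathcal N_{k,22}\end{pmatrix},\quad \mathcal SX_0=\begin{pmatrix}X_{0,1}\\X_{0,2}\end{pmatrix},\quad C\mathcal S^{-1}=(\mathcal C_1\ \ \mathcal C_2).$$ The reduced coefficients $(\tilde A,\tilde X_0,\tilde C,\tilde N_k)$ are either, for balanced truncation (BT), $(\mathcal A_{11},X_{0,1},\mathcal C_1,\mathcal N_{k,11})$ or, for the singular perturbation approximation (SPA), $(\mathcal A_{11}-\mathcal A_{12}\mathcal A_{22}^{-1}\mathcal A_{21},\,X_{0,1},\,\mathcal C_1-\mathcal C_2\mathcal A_{22}^{-1}\mathcal A_{21},\,\mathcal N_{k,11}-\mathcal N_{k,12}\mathcal A_{22}^{-1}\mathcal A_{21})$. Let $\tilde P=\int_0^\infty\tilde Z(t)\,dt$, where $\dot{\tilde Z}=\tilde A\tilde Z+\tilde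 Z\tilde A^\top+\frac1{\gamma^2}\sum_k\tilde N_k\tilde Z\tilde N_k^\top$, $\tilde Z(0)=\tilde X_0\tilde X_0^\top$. For SPA assume that $\mathcal A_{22}$ is invertible and that $\tilde P$ exists (the integral converges). Then $\tilde P$ exists for BT as well, and the equation $$\mathcal AY+Y\tilde A^\top+\frac1{\gamma^2}\sum_{k=1}^m\mathcal N_kY\tilde N_k^\top=-\begin{pmatrix}X_{0,1}\\X_{0,2}\end{pmatrix}X_{0,1}^\top$$ has a unique solution $Y=\begin{pmatrix}Y_1\\Y_2\end{pmatrix}\in\mathbb R^{n\times r}$. Put $(\mathbf A_{21},\bar{\mathbf A}_{21},\mathbf N_{k,21})=(\mathcal A_{21},0,\mathcal N_{k,21})$ for BT and $(0,-\mathcal A_{22}^{-1}\mathcal A_{21},\mathcal N_{k,21}-\mathcal N_{k,22}\mathcal A_{22}^{-1}\mathcal A_{21})$ for SPA, and $$\mathcal W=X_{0,2}X_{0,2}^\top+2Y_2\mathbf A_{21}^\top+2(\mathcal A_{21}\ \ \mathcal A_{22})Y\bar{\mathbf A}_{21}^\top+\frac1{\gamma^2}\sum_{k=1}^m\Big(2(\mathcal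 N_{k,21}\ \ \mathcal N_{k,22})Y\mathbf N_{k,21}^\top-\mathbf N_{k,21}\tilde P\mathbf N_{k,21}^\top\Big).$$ Then $\operatorname{tr}(\Theta_2\mathcal W)\ge0$. Moreover, for every control $u\in L^2([0,\infty);\mathbb R^m)$ and every $v_0\in\mathbb R^q$, let $y=Cx$ and $\tilde y=\tilde C\tilde x$ be the outputs of $$\dot x=Ax+\sum_kN_kx\,u_k,\quad x(0)=X_0v_0,\qquad\qquad \dot{\tilde x}=\tilde A\tilde x+\sum_k\tilde N_k\tilde x\,u_k,\quad\tilde x(0)=\tilde X_0v_0$$ (equations understood in integrated form, with continuous solutions), and let $u^0_k=0$ if $N_k=0$ and $u^0_k=u_k$ otherwise. Then $y-\tilde y\in L^2([0,\infty);\mathbb R^p)$ and $$\|y-\tilde y\|_{L^2}\le\big(\operatorname{tr}(\Theta_2\mathcal W)\big)^{1/2}\exp\!\Big(\tfrac12\|\gamma u^0\|_{L^2}^2\Big)\|v_0\|_2 .$$ -/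

import Mathlib

open scoped Matrix Kronecker

noncomputable section

namespace BilinearMOR

/-- Coefficients of a homogeneous bilinear system
`x' = A x + ∑ k, u k • N k x`, `x 0 = X₀ v₀`, `y = C x`, with state coordinates indexed by `ι`,
`m` controls, `p` outputs, and initial states spanned by the `q` columns of `X₀`. -/
structure HomSystem (m p q : ℕ) (ι : Type) where
  A : Matrix ι ι ℝ
  N : Fin m → Matrix ι ι ℝ
  X₀ : Matrix ι (Fin q) ℝ
  C : Matrix (Fin p) ι ℝ

/-- The norm of `L²([0, ∞))`, for functions with values in a Euclidean space. -/
def l2Norm {d : ℕ} (f : ℝ → EuclideanSpace ℝ (Fin d)) : ℝ :=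
  Real.sqrt (∫ t in Set.Ioi (0 : ℝ), ‖f t‖ ^ 2)

/-- `f` is (measurable and) square integrable on `[0, ∞)`. -/
def IsL2 {d : ℕ} (f : ℝ → EuclideanSpace ℝ (Fin d)) : Prop :=
  MeasureTheory.MemLp f 2 (MeasureTheory.volume.restrict (Set.Ioi (0 : ℝ)))

section general

variable {m p q : ℕ} {ι κ : Type} [Fintype ι] [DecidableEq ι] [Fintype κ] [DecidableEq κ]

/-- The generalized Sylvester operator
`Y ↦ A Y + Y Bᵀ + γ⁻² ∑ k, N k Y (M k)ᵀ`. -/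
def sylvOp (A : Matrix ι ι ℝ) (N : Fin m → Matrix ι ι ℝ) (B : Matrix κ κ ℝ)
    (M : Fin m → Matrix κ κ ℝ) (γ : ℝ) (Y : Matrix ι κ ℝ) : Matrix ι κ ℝ :=
  A * Y + Y * Bᵀ + (1 / γ ^ 2) • ∑ k, N k * Y * (M k)ᵀ

/-- The generalized Lyapunov operator `Z ↦ A Z + Z Aᵀ + γ⁻² ∑ k, N k Z (N k)ᵀ`. -/
def lyapOp (A : Matrix ι ι ℝ) (N : Fin m → Matrix ι ι ℝ) (γ : ℝ) (Z : Matrix ι ι ℝ) :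
    Matrix ι ι ℝ :=
  sylvOp A N A N γ Z

/-- `Z` solves, on `[0, ∞)`, the matrix differential equation
`Z' = A Z + Z Aᵀ + γ⁻² ∑ k, N k Z (N k)ᵀ`, `Z 0 = K` (derivatives are taken entrywise, and are
one-sided at `t = 0`). -/
def IsLyapFlow (A : Matrix ι ι ℝ) (N : Fin m → Matrix ι ι ℝ) (γ : ℝ) (K : Matrix ι ι ℝ)
    (Z : ℝ → Matrix ι ι ℝ) : Prop :=
  Z 0 = K ∧ ∀ t, 0 ≤ t → ∀ i j,
    HasDerivWithinAt (fun τ => Z τ i j) (lyapOp A N γ (Z t) i j) (Set.Ici 0) t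

/-- `P = ∫₀^∞ Z(t) dt`, where `Z' = A Z + Z Aᵀ + γ⁻² ∑ k, N k Z (N k)ᵀ`, `Z 0 = K`; this includes
the convergence of the integral. -/
def IsGramian (A : Matrix ι ι ℝ) (N : Fin m → Matrix ι ι ℝ) (γ : ℝ) (K P : Matrix ι ι ℝ) : Prop :=
  ∃ Z : ℝ → Matrix ι ι ℝ, IsLyapFlow A N γ K Z ∧ ∀ i j,
    MeasureTheory.IntegrableOn (fun t => Z t i j) (Set.Ioi (0 : ℝ)) ∧
      P i j = ∫ t in Set.Ioi (0 : ℝ), Z t i j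

/-- `P` is the first Gramian of the system (initial value `X₀ X₀ᵀ`). -/
def HomSystem.IsGramianP (sys : HomSystem m p q ι) (γ : ℝ) (P : Matrix ι ι ℝ) : Prop :=
  IsGramian sys.A sys.N γ (sys.X₀ * sys.X₀ᵀ) P

/-- `Q` is the second Gramian of the system (adjoint Lyapunov operator, initial value `Cᵀ C`). -/
def HomSystem.IsGramianQ (sys : HomSystem m p q ι) (γ : ℝ) (Q : Matrix ι ι ℝ) : Prop :=
  IsGramian sys.Aᵀ (fun k => (sys.N k)ᵀ) γ (sys.Cᵀ * sys.C) Q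

/-- The matrix `A ⊗ I + I ⊗ A + γ⁻² ∑ k, N k ⊗ N k`. -/
def HomSystem.kronMatrix (sys : HomSystem m p q ι) (γ : ℝ) : Matrix (ι × ι) (ι × ι) ℝ :=
  sys.A ⊗ₖ (1 : Matrix ι ι ℝ) + (1 : Matrix ι ι ℝ) ⊗ₖ sys.A +
    (1 / γ ^ 2) • ∑ k, sys.N k ⊗ₖ sys.N k

/-- All complex eigenvalues of `A ⊗ I + I ⊗ A + γ⁻² ∑ k, N k ⊗ N k` have negative real part. -/
def HomSystem.IsStable (sys : HomSystem m p q ι) (γ : ℝ) : Prop :=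
  spectrum ℂ ((sys.kronMatrix γ).map (algebraMap ℝ ℂ)) ⊆ {z : ℂ | z.re < 0}

/-- `x` is the state on `[0, ∞)` for the control `u` and the initial state `X₀ v₀`:
`x(t) = X₀ v₀ + ∫₀ᵗ (A x(τ) + ∑ k, u k(τ) N k x(τ)) dτ`. -/
def HomSystem.IsState (sys : HomSystem m p q ι) (u : ℝ → EuclideanSpace ℝ (Fin m))
    (v₀ : EuclideanSpace ℝ (Fin q)) (x : ℝ → EuclideanSpace ℝ ι) : Prop :=
  ContinuousOn x (Set.Ici 0) ∧ ∀ t, 0 ≤ t →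
    x t = Matrix.toEuclideanLin sys.X₀ v₀ +
      ∫ τ in (0 : ℝ)..t, (Matrix.toEuclideanLin sys.A (x τ) +
        ∑ k, u τ k • Matrix.toEuclideanLin (sys.N k) (x τ))

/-- `y = C x` is the output on `[0, ∞)` for the control `u` and the initial state `X₀ v₀`. -/
def HomSystem.IsOutput (sys : HomSystem m p q ι) (u : ℝ → EuclideanSpace ℝ (Fin m))
    (v₀ : EuclideanSpace ℝ (Fin q)) (y : ℝ → EuclideanSpace ℝ (Fin p)) : Prop :=
  ∃ x : ℝ → EuclideanSpace ℝ ι, sys.IsState u v₀ x ∧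
    ∀ t, 0 ≤ t → y t = Matrix.toEuclideanLin sys.C (x t)

open Classical in
/-- The control components which really enter the bilinear part: `u k` is replaced by `0`
if `N k = 0`. -/
def HomSystem.effControl (sys : HomSystem m p q ι) (u : ℝ → EuclideanSpace ℝ (Fin m)) (t : ℝ) :
    EuclideanSpace ℝ (Fin m) :=
  WithLp.toLp 2 (fun k => if sys.N k = 0 then 0 else u t k)

/-- The system in the state coordinates `S x`, where `T` is the inverse of `S`. -/
def HomSystem.transform (sys : HomSystem m p q ι) (S : Matrix κ ι ℝ) (T : Matrix ι κ ℝ) :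
    HomSystem m p q κ where
  A := S * sys.A * T
  N := fun k => S * sys.N k * T
  X₀ := S * sys.X₀
  C := sys.C * T

/-- `S`, with inverse `T`, is a balancing transformation with Hankel singular values `θ`: for the
Gramians `P₀`, `Q` of the system, `S P₀ Sᵀ = S⁻ᵀ Q S⁻¹ = diag θ`. -/
def HomSystem.IsBalancing (sys : HomSystem m p q ι) (γ : ℝ) (S : Matrix κ ι ℝ) (T : Matrix ι κ ℝ)
    (θ : κ → ℝ) : Prop :=
  S * T = 1 ∧ T * S = 1 ∧ ∃ P₀ Q : Matrix ι ι ℝ, sys.IsGramianP γ P₀ ∧ sys.IsGramianQ γ Q ∧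
    S * P₀ * Sᵀ = Matrix.diagonal θ ∧ Tᵀ * Q * T = Matrix.diagonal θ

end general

/-- Balanced truncation and singular perturbation approximation. -/
inductive Method
  | bt
  | spa

section reduction

variable {m p q r s : ℕ}

/-- The reduced system of order `r` which `Method` assigns to a system whose state is partitioned
into `r` retained and `s` discarded coordinates. -/
def HomSystem.reduced (bal : HomSystem m p q (Fin r ⊕ Fin s)) : Method → HomSystem m p q (Fin r)
  | .bt =>
    { A := bal.A.toBlocks₁₁
      N := fun k => (bal.N k).toBlocks₁₁
      X₀ := bal.X₀.toRows₁
      C := bal.C.toCols₁ }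
  | .spa =>
    { A := bal.A.toBlocks₁₁ - bal.A.toBlocks₁₂ * bal.A.toBlocks₂₂⁻¹ * bal.A.toBlocks₂₁
      N := fun k =>
        (bal.N k).toBlocks₁₁ - (bal.N k).toBlocks₁₂ * bal.A.toBlocks₂₂⁻¹ * bal.A.toBlocks₂₁
      X₀ := bal.X₀.toRows₁
      C := bal.C.toCols₁ - bal.C.toCols₂ * bal.A.toBlocks₂₂⁻¹ * bal.A.toBlocks₂₁ }

/-- The matrix `𝐀₂₁` of the weight: `A₂₁` for BT and `0` for SPA. -/
def HomSystem.boldA (bal : HomSystem m p q (Fin r ⊕ Fin s)) : Method → Matrix (Fin s) (Fin r) ℝ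
  | .bt => bal.A.toBlocks₂₁
  | .spa => 0

/-- The matrix `𝐀̄₂₁` of the weight: `0` for BT and `-A₂₂⁻¹ A₂₁` for SPA. -/
def HomSystem.boldABar (bal : HomSystem m p q (Fin r ⊕ Fin s)) : Method → Matrix (Fin s) (Fin r) ℝ
  | .bt => 0
  | .spa => -(bal.A.toBlocks₂₂⁻¹ * bal.A.toBlocks₂₁)

/-- The matrices `𝐍ₖ,₂₁` of the weight: `Nₖ,₂₁` for BT and `Nₖ,₂₁ - Nₖ,₂₂ A₂₂⁻¹ A₂₁` for SPA. -/
def HomSystem.boldN (bal : HomSystem m p q (Fin r ⊕ Fin s)) (k : Fin m) :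
    Method → Matrix (Fin s) (Fin r) ℝ
  | .bt => (bal.N k).toBlocks₂₁
  | .spa => (bal.N k).toBlocks₂₁ - (bal.N k).toBlocks₂₂ * bal.A.toBlocks₂₂⁻¹ * bal.A.toBlocks₂₁

/-- `Y` solves the mixed equation
`A Y + Y Ãᵀ + γ⁻² ∑ k, N k Y (Ñ k)ᵀ = - X₀ X₀,₁ᵀ`, with the coefficients `A`, `N k`, `X₀` of the
given system and `Ã`, `Ñ k` of its reduced system. -/
def HomSystem.IsMixedSol (bal : HomSystem m p q (Fin r ⊕ Fin s)) (μ : Method) (γ : ℝ)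
    (Y : Matrix (Fin r ⊕ Fin s) (Fin r) ℝ) : Prop :=
  sylvOp bal.A bal.N (bal.reduced μ).A (bal.reduced μ).N γ Y = -(bal.X₀ * bal.X₀.toRows₁ᵀ)

/-- The weight of the error bound; `Y.toRows₂` is `Y₂`, and `toRows₂` of a square block matrix is
its second block row. -/
def HomSystem.weight (bal : HomSystem m p q (Fin r ⊕ Fin s)) (μ : Method) (γ : ℝ)
    (Pr : Matrix (Fin r) (Fin r) ℝ) (Y : Matrix (Fin r ⊕ Fin s) (Fin r) ℝ) :
    Matrix (Fin s) (Fin s) ℝ :=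
  bal.X₀.toRows₂ * bal.X₀.toRows₂ᵀ + (2 : ℝ) • (Y.toRows₂ * (bal.boldA μ)ᵀ) +
    (2 : ℝ) • (bal.A.toRows₂ * Y * (bal.boldABar μ)ᵀ) +
    (1 / γ ^ 2) • ∑ k, ((2 : ℝ) • ((bal.N k).toRows₂ * Y * (bal.boldN k μ)ᵀ) -
      bal.boldN k μ * Pr * (bal.boldN k μ)ᵀ)

end reduction

end BilinearMOR

end

open scoped Matrix Kronecker

noncomputable section

namespace BilinearMOR

set_option linter.unusedSectionVars false

/-! The error `y - yr` is the output of the block diagonal sum of the balanced and the reduced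
system, so one output bound for homogeneous bilinear systems, applied to this error system,
suffices.

The output bound: let `F` be the flow of the adjoint Lyapunov operator started at `Cᵀ C`. Completing
a square with weight `γ` absorbs each cross term of the derivative of `x(t)ᵀ F(T - t) x(t)` into `γ²
u_k²` times the form itself plus the `N k` term of the Lyapunov operator. Hence `exp (-∫₀ᵗ γ² ‖u‖²)
x(t)ᵀ F(T - t) x(t)` does not increase (`quadratic_form_state_le`). Comparing `t = 0` with `t = T`,
passing to the primal flow by trace duality and integrating over `T` gives `‖y‖² ≤ tr (C P Cᵀ) exp
‖γ u‖² ‖v₀‖²` with the Gramian `P`. Controls with `N k = 0` may be set to zero beforehand.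

The trace: the Gramian of the error system has the blocks `Θ`, `Y`, its transpose, and `Pr`. With `V
= (1; 𝐀̄₂₁)` one has `A V = (Ã; 𝐀₂₁)`, `N k V = (Ñ k; 𝐍ₖ,₂₁)` and `C V = C̃` for both methods.
Compressing the adjoint Lyapunov equation of `Θ` by `V` expresses the three traces of the error
Gramian through `Θ₁` and `Θ₂`; the `Θ₁` parts cancel and `tr (Θ₂ 𝒲)` remains
(`HomSystem.trace_error_eq`). It is nonnegative as an integral of traces of positive semidefinite
matrices.

Existence: for BT, `Θ₁` solves the reduced Lyapunov equation with an enlarged right-hand side, which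
bounds the integral of the reduced flow. A kernel element `Y` of the mixed operator is stationary
for the mixed flow; as an off-diagonal block of a positive semidefinite flow it is controlled by the
product of a decaying diagonal block (stability) and a bounded one (`tr (Θ₁ Z)` does not increase),
hence it vanishes (`sylvOp_injective`). -/

open Filter Topology NormedSpace MeasureTheory Set

/-! ### Exponential flows of bounded operators -/

section flow

variable {E F : Type*} [NormedAddCommGroup E] [NormedSpace ℝ E] [CompleteSpace E]
  [NormedAddCommGroup F] [NormedSpace ℝ F] [CompleteSpace F]

/-- The flow `t ↦ exp (t L) v` of the linear differential equation `w' = L w`, `w 0 = v`. -/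
def flow (L : E →L[ℝ] E) (t : ℝ) (v : E) : E := exp (t • L) v

theorem flow_zero (L : E →L[ℝ] E) (v : E) : flow L 0 v = v := by simp [flow]

theorem flow_add (L : E →L[ℝ] E) (t : ℝ) (v w : E) :
    flow L t (v + w) = flow L t v + flow L t w := by
  simp [flow]

theorem flow_neg (L : E →L[ℝ] E) (t : ℝ) (v : E) : flow L t (-v) = -flow L t v := by
  simp [flow]

theorem hasDerivAt_flow (L : E →L[ℝ] E) (v : E) (t : ℝ) :
    HasDerivAt (fun t => flow L t v) (L (flow L t v)) t := by
  have h := (hasDerivAt_exp_smul_const' (𝕂 := ℝ) L t).clm_apply (hasDerivAt_const t v)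
  simpa [flow] using h

theorem continuous_flow (L : E →L[ℝ] E) (v : E) : Continuous (fun t => flow L t v) :=
  continuous_iff_continuousAt.2 fun t => (hasDerivAt_flow L v t).continuousAt

theorem flow_map (L : E →L[ℝ] E) (t : ℝ) (v : E) : flow L t (L v) = L (flow L t v) := by
  have h : Commute (exp (t • L)) L := (((Commute.refl L).smul_left t).exp_left)
  exact congrArg (fun f : E →L[ℝ] E => f v) h.eq

theorem hasSum_exp_apply {𝕜 : Type*} [RCLike 𝕜] [NormedSpace 𝕜 F] (L : F →L[𝕜] F) (v : F) :
    HasSum (fun n : ℕ => ((n.factorial : 𝕜)⁻¹) • (L ^ n) v) (exp L v) := by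
  have h := (exp_series_hasSum_exp' (𝕂 := 𝕜) L).mapL (ContinuousLinearMap.apply 𝕜 F v)
  simpa using h

/-- `J` intertwines all powers, hence the exponential series termwise. `K` may be complex linear, so
that spectral information over `ℂ` reaches real matrix flows. -/
theorem exp_intertwine {𝕜 : Type*} [RCLike 𝕜] [NormedSpace 𝕜 F]
    (L : E →L[ℝ] E) (K : F →L[𝕜] F) (J : E →L[ℝ] F) (h : ∀ v, J (L v) = K (J v)) (v : E) :
    J (exp L v) = exp K (J v) := by
  have h1 := (hasSum_exp_apply (𝕜 := ℝ) L v).mapL J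
  have h2 := hasSum_exp_apply K (J v)
  have hp : ∀ n : ℕ, J ((L ^ n) v) = (K ^ n) (J v) := by
    intro n
    induction n with
    | zero => simp
    | succ n ih =>
      rw [pow_succ', pow_succ', mul_apply_eq_comp, mul_apply_eq_comp, h, ih]
  simp only [map_smul, hp, inv_natCast_smul_eq ℝ 𝕜] at h1
  exact h1.unique h2

theorem flow_intertwine (L : E →L[ℝ] E) (K : F →L[ℝ] F) (J : E →L[ℝ] F)
    (h : ∀ v, J (L v) = K (J v)) (t : ℝ) (v : E) : J (flow L t v) = flow K t (J v) := by
  refine exp_intertwine (t • L) (t • K) J (fun v => ?_) v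
  simp [h]

theorem flow_dual (L : E →L[ℝ] E) (K : F →L[ℝ] F) (B : E →L[ℝ] F →L[ℝ] ℝ)
    (h : ∀ v w, B (L v) w = B v (K w)) (t : ℝ) (v : E) (w : F) :
    B (flow L t v) w = B v (flow K t w) := by
  have h1 := (hasSum_exp_apply (𝕜 := ℝ) (t • L) v).mapL (B.flip w)
  have h2 := (hasSum_exp_apply (𝕜 := ℝ) (t • K) w).mapL (B v)
  have hp : ∀ n : ℕ, ∀ v, B (((t • L) ^ n) v) w = B v (((t • K) ^ n) w) := by
    intro n
    induction n with
    | zero => intro v; rfl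
    | succ n ih =>
      intro v
      rw [pow_succ, pow_succ', mul_apply_eq_comp, mul_apply_eq_comp, ih]
      simp [h, -FunLike.coe_pow]
  simp only [map_smul, ContinuousLinearMap.flip_apply, hp] at h1 h2
  exact h1.unique h2

/-- Uniqueness for linear differential equations on `[0, ∞)`. -/
theorem eq_flow (L : E →L[ℝ] E) (z : ℝ → E)
    (hz : ∀ t, 0 ≤ t → HasDerivWithinAt z (L (z t)) (Set.Ici 0) t) (t : ℝ) (ht : 0 ≤ t) :
    z t = flow L t (z 0) := by
  -- Transporting `z s` forward by the remaining time `t - s` gives a constant curve; its values at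
  -- `s = 0` and `s = t` are compared.
  have h : ∀ s ∈ Set.Icc 0 t,
      HasDerivWithinAt (fun s => exp ((t - s) • L) (z s)) 0 (Set.Icc 0 t) s := by
    intro s hs
    have h1 : HasDerivAt (fun s : ℝ => exp ((t - s) • L)) (-(exp ((t - s) • L) * L)) s := by
      have := (hasDerivAt_exp_smul_const (𝕂 := ℝ) L (t - s)).scomp s
        ((hasDerivAt_id s).const_sub t)
      simp only [neg_smul, one_smul] at this
      exact this
    have h2 := (h1.hasDerivWithinAt (s := Set.Icc 0 t)).clm_apply
      ((hz s hs.1).mono Set.Icc_subset_Ici_self)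
    simpa using h2
  have hc := constant_of_derivWithin_zero (fun s hs => (h s hs).differentiableWithinAt)
    (fun s hs => (h s (Set.Ico_subset_Icc_self hs)).derivWithin
      (uniqueDiffOn_Icc (lt_of_le_of_lt hs.1 hs.2) s (Set.Ico_subset_Icc_self hs))) t ⟨ht, le_rfl⟩
  simpa [flow] using hc

end flow

/-! ### Decay of the exponential from the location of the eigenvalues -/

section spectral

variable {V : Type*} [NormedAddCommGroup V] [NormedSpace ℂ V] [FiniteDimensional ℂ V]

theorem exp_apply_of_eigenvector (f : V →L[ℂ] V) (a : ℂ) (w : V) (hw : f w = a • w) :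
    exp f w = Complex.exp a • w := by
  have := FiniteDimensional.complete ℂ V
  have h1 := hasSum_exp_apply f w
  have h2 : HasSum (fun n : ℕ => ((n.factorial : ℂ)⁻¹ • a ^ n) • w) (exp a • w) :=
    (exp_series_hasSum_exp' (𝕂 := ℂ) a).smul_const w
  have hp : ∀ n : ℕ, (f ^ n) w = a ^ n • w := by
    intro n
    induction n with
    | zero => simp
    | succ n ih =>
      rw [pow_succ, mul_apply_eq_comp, hw, map_smul, ih, smul_smul, pow_succ, mul_comm]
  rw [Complex.exp_eq_exp_ℂ]
  refine h1.unique ?_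
  simpa only [hp, smul_eq_mul, mul_smul] using h2

/-- Since `f` commutes with `exp f`, it acts on each eigenspace of `exp f` and has an eigenvector
there. So every eigenvalue of `exp f` is `exp a` for some eigenvalue `a` of `f`. -/
theorem norm_lt_one_of_mem_spectrum_exp (f : V →L[ℂ] V)
    (hf : ∀ z, Module.End.HasEigenvalue (f : V →ₗ[ℂ] V) z → z.re < 0) (z : ℂ)
    (hz : z ∈ spectrum ℂ (exp f)) : ‖z‖ < 1 := by
  have := FiniteDimensional.complete ℂ V
  set g : Module.End ℂ V := ((exp f : V →L[ℂ] V) : V →ₗ[ℂ] V) with hg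
  have hz' : z ∈ spectrum ℂ g := by
    rw [← AlgEquiv.spectrum_eq (Module.End.toContinuousLinearMap V) g]
    exact hz
  rw [← Module.End.hasEigenvalue_iff_mem_spectrum] at hz'
  have hcomm : Commute f (exp f) := (Commute.refl f).exp_right
  have hinv : ∀ x ∈ Module.End.eigenspace g z, (f : V →ₗ[ℂ] V) x ∈ Module.End.eigenspace g z := by
    intro x hx
    rw [Module.End.mem_eigenspace_iff] at hx ⊢
    have := congrArg (fun k : V →L[ℂ] V => k x) hcomm.eq
    simp only [mul_apply_eq_comp] at this
    change exp f (f x) = z • f x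
    rw [← this, ← map_smul]
    exact congrArg f hx
  have : Nontrivial (Module.End.eigenspace g z) := Submodule.nontrivial_iff_ne_bot.2 hz'
  obtain ⟨a, ha⟩ := Module.End.exists_eigenvalue ((f : V →ₗ[ℂ] V).restrict hinv)
  obtain ⟨w, hw⟩ := ha.exists_hasEigenvector
  have hw0 : (w : V) ≠ 0 := by simpa using hw.2
  have hfw : f (w : V) = a • (w : V) := congrArg Subtype.val hw.apply_eq_smul
  have hre := hf a (Module.End.hasEigenvalue_of_hasEigenvector
    (x := (w : V)) ⟨Module.End.mem_eigenspace_iff.2 hfw, hw0⟩)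
  have h1 : exp f (w : V) = z • (w : V) := Module.End.mem_eigenspace_iff.1 w.2
  rw [exp_apply_of_eigenvector f a w hfw] at h1
  rw [← smul_left_injective ℂ hw0 h1, Complex.norm_exp]
  simpa using hre

/-- The spectral radius of `exp f` is below some `c < 1`, and Gelfand's formula bounds the powers
eventually by `c ^ n`. -/
theorem tendsto_exp_pow_apply (f : V →L[ℂ] V)
    (hf : ∀ z, Module.End.HasEigenvalue (f : V →ₗ[ℂ] V) z → z.re < 0) (v : V) :
    Tendsto (fun n : ℕ => (exp f ^ n) v) atTop (𝓝 0) := by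
  have := FiniteDimensional.complete ℂ V
  rcases subsingleton_or_nontrivial V with hV | hV
  · exact tendsto_const_nhds.congr fun n => Subsingleton.elim _ _
  have hr : spectralRadius ℂ (exp f) < (1 : NNReal) :=
    spectrum.spectralRadius_lt_of_forall_lt (exp f) fun z hz =>
      norm_lt_one_of_mem_spectrum_exp f hf z hz
  obtain ⟨c, hc1, hc2⟩ := ENNReal.lt_iff_exists_nnreal_btwn.1 hr
  have hg := spectrum.pow_nnnorm_pow_one_div_tendsto_nhds_spectralRadius (exp f)
  have hc3 : (c : ℝ) < 1 := by exact_mod_cast hc2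
  have hle : ∀ᶠ n : ℕ in atTop, ‖(exp f ^ n) v‖ ≤ (c : ℝ) ^ n * ‖v‖ := by
    filter_upwards [hg.eventually_lt_const hc1, eventually_gt_atTop 0] with n hn hn0
    have h1 : (‖exp f ^ n‖₊ : ENNReal) ≤ (c : ENNReal) ^ n := by
      have := ENNReal.rpow_le_rpow hn.le (Nat.cast_nonneg (α := ℝ) n)
      rw [← ENNReal.rpow_mul, one_div, inv_mul_cancel₀ (by positivity), ENNReal.rpow_one,
        ENNReal.rpow_natCast] at this
      exact this
    have h2 : ‖exp f ^ n‖ ≤ (c : ℝ) ^ n := by exact_mod_cast h1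
    exact (ContinuousLinearMap.le_opNorm _ _).trans (by gcongr)
  refine squeeze_zero_norm' hle ?_
  simpa using (tendsto_pow_atTop_nhds_zero_of_lt_one c.2 hc3).mul_const ‖v‖

end spectral

/-! ### Invariant cones and integrals of flows -/

section generic

variable {E : Type*} [NormedAddCommGroup E] [NormedSpace ℝ E] [CompleteSpace E]

theorem exp_mem_cone {C : Set E} (hC : IsClosed C) (h0 : (0 : E) ∈ C)
    (hadd : ∀ v ∈ C, ∀ w ∈ C, v + w ∈ C) (hsmul : ∀ c : ℝ, 0 ≤ c → ∀ v ∈ C, c • v ∈ C)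
    (L : E →L[ℝ] E) (hL : ∀ v ∈ C, L v ∈ C) (v : E) (hv : v ∈ C) : exp L v ∈ C := by
  have hp : ∀ n : ℕ, (L ^ n) v ∈ C := by
    intro n
    induction n with
    | zero => simpa using hv
    | succ n ih => rw [pow_succ', mul_apply_eq_comp]; exact hL _ ih
  refine hC.mem_of_tendsto (hasSum_exp_apply (𝕜 := ℝ) L v) (Eventually.of_forall fun s => ?_)
  exact Finset.sum_induction _ (· ∈ C) (fun a b ha hb => hadd a ha b hb) h0
    fun n _ => hsmul _ (by positivity) _ (hp n)

/-- An Euler step corrected at second order, `1 + h L + h² R`, preserves the cone. Up to the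
positive scalar `exp (-t/h)`, `exp (t (L + h R))` is the exponential of `t/h` times this step, so it
preserves the cone as well; then `h → 0`. -/
theorem flow_mem_cone {C : Set E} (hC : IsClosed C) (h0 : (0 : E) ∈ C)
    (hadd : ∀ v ∈ C, ∀ w ∈ C, v + w ∈ C) (hsmul : ∀ c : ℝ, 0 ≤ c → ∀ v ∈ C, c • v ∈ C)
    (L R : E →L[ℝ] E) (hL : ∀ h : ℝ, 0 < h → ∀ v ∈ C, v + h • L v + h ^ 2 • R v ∈ C)
    (t : ℝ) (ht : 0 ≤ t) (v : E) (hv : v ∈ C) : flow L t v ∈ C := by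
  let _ : NormedAlgebra ℚ (E →L[ℝ] E) := NormedAlgebra.restrictScalars ℚ ℝ _
  have hpos : ∀ h : ℝ, 0 < h → exp (t • (L + h • R)) v ∈ C := by
    intro h hh
    have h1 : exp ((t / h) • (1 + h • (L + h • R))) v ∈ C := by
      refine exp_mem_cone hC h0 hadd hsmul _ (fun w hw => ?_) v hv
      refine hsmul _ (by positivity) _ ?_
      have := hL h hh w hw
      simpa [smul_smul, pow_two, add_assoc] using this
    have h2 : t • (L + h • R) = (-(t / h)) • (1 : E →L[ℝ] E) + (t / h) • (1 + h • (L + h • R)) := by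
      rw [smul_add (t / h), smul_smul (t / h) h, div_mul_cancel₀ _ hh.ne', neg_smul,
        neg_add_cancel_left]
    have h3 : exp ((-(t / h)) • (1 : E →L[ℝ] E)) = Real.exp (-(t / h)) • (1 : E →L[ℝ] E) := by
      have := algebraMap_exp_comm (𝕂 := ℝ) (𝔸 := E →L[ℝ] E) (-(t / h))
      rw [Algebra.algebraMap_eq_smul_one, Algebra.algebraMap_eq_smul_one] at this
      rw [← this, Real.exp_eq_exp_ℝ]
    rw [h2, exp_add_of_commute ((Commute.one_left _).smul_left _), h3]
    exact hsmul _ (Real.exp_nonneg _) _ h1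
  have hlim : Tendsto (fun h : ℝ => exp (t • (L + h • R)) v) (𝓝[>] 0) (𝓝 (flow L t v)) := by
    have hc : Continuous (fun h : ℝ => exp (t • (L + h • R)) v) :=
      (exp_continuous.comp (by fun_prop : Continuous fun h : ℝ => t • (L + h • R))).clm_apply
        continuous_const
    have := (hc.tendsto 0).mono_left (nhdsWithin_le_nhds (s := Ioi 0))
    simpa [flow] using this
  exact hC.mem_of_tendsto hlim (eventually_mem_nhdsWithin.mono fun h hh => hpos h hh)

theorem tendsto_flow_zero (L : E →L[ℝ] E) (v : E)
    (hi : IntegrableOn (fun t => flow L t v) (Ioi 0)) :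
    Tendsto (fun t => flow L t v) atTop (𝓝 0) :=
  tendsto_zero_of_hasDerivAt_of_integrableOn_Ioi (fun t _ => hasDerivAt_flow L v t)
    (L.integrable_comp hi) hi

/-- The integral of the derivative is the limit at infinity minus `v`. Integrability of the flow
alone makes the limit zero, so no spectral condition is needed for a Gramian to solve its Lyapunov
equation. -/
theorem map_integral_flow (L : E →L[ℝ] E) (v : E)
    (hi : IntegrableOn (fun t => flow L t v) (Ioi 0)) :
    L (∫ t in Ioi (0 : ℝ), flow L t v) = -v := by
  rw [← ContinuousLinearMap.integral_comp_comm L hi,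
    integral_Ioi_of_hasDerivAt_of_tendsto' (fun t _ => hasDerivAt_flow L v t)
      (L.integrable_comp hi) (tendsto_flow_zero L v hi), flow_zero, zero_sub]

end generic

/-! ### Matrices as a real Banach space -/

section norm

variable {ι κ : Type*} [Fintype ι] [Fintype κ]

/-- The maximum norm on matrices, with the standard topology of matrices as underlying topology. -/
abbrev matrixNormedAddCommGroup : NormedAddCommGroup (Matrix ι κ ℝ) where
  toAddCommGroup := Matrix.addCommGroup
  norm A := Norm.norm (E := ι → κ → ℝ) A
  -- The topology is kept definitionally equal to the standard one on matrices, so the two instances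
  -- do not conflict.
  toMetricSpace := MetricSpace.replaceTopology (U := instTopologicalSpaceMatrix)
    (inferInstanceAs (MetricSpace (ι → κ → ℝ))) rfl
  dist_eq := by
    have h : ∀ A B : ι → κ → ℝ, dist A B = ‖-A + B‖ := dist_eq_norm_neg_add
    exact h

attribute [local instance] matrixNormedAddCommGroup

/-- The real normed space of matrices with the maximum norm. -/
abbrev matrixNormedSpace : NormedSpace ℝ (Matrix ι κ ℝ) where
  toModule := Matrix.module
  norm_smul_le := by
    have h : ∀ (a : ℝ) (A : ι → κ → ℝ), ‖a • A‖ ≤ ‖a‖ * ‖A‖ := norm_smul_le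
    exact h

end norm

attribute [local instance] matrixNormedAddCommGroup matrixNormedSpace

theorem matrix_completeSpace {ι κ : Type*} [Fintype ι] [Fintype κ] :
    CompleteSpace (Matrix ι κ ℝ) := FiniteDimensional.complete ℝ _

attribute [local instance] matrix_completeSpace

section entries

variable {ι κ : Type*} [Fintype ι] [Fintype κ]

/-- Matrices as doubly indexed families. -/
def ofCLE : (ι → κ → ℝ) ≃L[ℝ] Matrix ι κ ℝ :=
  (Matrix.ofLinearEquiv ℝ).toContinuousLinearEquiv

/-- The entry of a matrix as a continuous linear map. -/
def entryCLM (i : ι) (j : κ) : Matrix ι κ ℝ →L[ℝ] ℝ :=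
  LinearMap.toContinuousLinearMap (Matrix.entryLinearMap ℝ ℝ i j)

@[simp] theorem entryCLM_apply (i : ι) (j : κ) (A : Matrix ι κ ℝ) : entryCLM i j A = A i j := rfl

theorem hasDerivWithinAt_matrix_iff {Z : ℝ → Matrix ι κ ℝ} {D : Matrix ι κ ℝ} {s : Set ℝ} {t : ℝ} :
    HasDerivWithinAt Z D s t ↔ ∀ i j, HasDerivWithinAt (fun τ => Z τ i j) (D i j) s t := by
  refine ⟨fun h i j => (entryCLM i j).hasFDerivAt.comp_hasDerivWithinAt t h, fun h => ?_⟩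
  have h1 : HasDerivWithinAt (fun τ => (fun i j => Z τ i j : ι → κ → ℝ)) (fun i j => D i j) s t :=
    hasDerivWithinAt_pi.2 fun i => hasDerivWithinAt_pi.2 fun j => h i j
  exact (ofCLE (ι := ι) (κ := κ)).toContinuousLinearMap.hasFDerivAt.comp_hasDerivWithinAt t h1

theorem integrable_matrix_iff {Z : ℝ → Matrix ι κ ℝ} {μ : Measure ℝ} :
    Integrable Z μ ↔ ∀ i j, Integrable (fun τ => Z τ i j) μ := by
  refine ⟨fun h i j => (entryCLM i j).integrable_comp h, fun h => ?_⟩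
  have h1 : Integrable (fun τ => (fun i j => Z τ i j : ι → κ → ℝ)) μ :=
    integrable_pi_iff.2 fun i => integrable_pi_iff.2 fun j => h i j
  exact (ofCLE (ι := ι) (κ := κ)).toContinuousLinearMap.integrable_comp h1

theorem integral_matrix_apply {Z : ℝ → Matrix ι κ ℝ} {μ : Measure ℝ} (h : Integrable Z μ)
    (i : ι) (j : κ) : (∫ t, Z t ∂μ) i j = ∫ t, Z t i j ∂μ :=
  ((entryCLM i j).integral_comp_comm h).symm

end entries

/-! ### Lyapunov flows, positivity, Gramians and duality -/

section matrix

variable {m : ℕ} {ι κ : Type} [Fintype ι] [DecidableEq ι] [Fintype κ] [DecidableEq κ]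

/-- `sylvOp` as a continuous linear map. -/
def sylvCLM (A : Matrix ι ι ℝ) (N : Fin m → Matrix ι ι ℝ) (B : Matrix κ κ ℝ)
    (M : Fin m → Matrix κ κ ℝ) (γ : ℝ) : Matrix ι κ ℝ →L[ℝ] Matrix ι κ ℝ :=
  LinearMap.toContinuousLinearMap
    { toFun := sylvOp A N B M γ
      map_add' := fun X Y => by
        simp only [sylvOp, Matrix.mul_add, Matrix.add_mul, Finset.sum_add_distrib, smul_add]
        abel
      map_smul' := fun c X => by
        simp only [sylvOp, Matrix.mul_smul, Matrix.smul_mul, ← Finset.smul_sum, smul_add,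
          RingHom.id_apply, smul_comm c] }

@[simp] theorem sylvCLM_apply (A : Matrix ι ι ℝ) (N : Fin m → Matrix ι ι ℝ) (B : Matrix κ κ ℝ)
    (M : Fin m → Matrix κ κ ℝ) (γ : ℝ) (Y : Matrix ι κ ℝ) :
    sylvCLM A N B M γ Y = sylvOp A N B M γ Y := rfl

/-- `lyapOp` as a continuous linear map. -/
abbrev lyapCLM (A : Matrix ι ι ℝ) (N : Fin m → Matrix ι ι ℝ) (γ : ℝ) :
    Matrix ι ι ℝ →L[ℝ] Matrix ι ι ℝ := sylvCLM A N A N γ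

theorem posSemidef_mul_mul_transpose {Z : Matrix ι ι ℝ} (hZ : Z.PosSemidef) (B : Matrix κ ι ℝ) :
    (B * Z * Bᵀ).PosSemidef := by
  simpa using hZ.mul_mul_conjTranspose_same B

theorem posSemidef_transpose_mul_mul {Z : Matrix ι ι ℝ} (hZ : Z.PosSemidef) (B : Matrix ι κ ℝ) :
    (Bᵀ * Z * B).PosSemidef := by
  simpa using hZ.conjTranspose_mul_mul_same B

theorem posSemidef_mul_transpose (B : Matrix κ ι ℝ) : (B * Bᵀ).PosSemidef := by
  simpa using Matrix.posSemidef_self_mul_conjTranspose B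

theorem posSemidef_transpose_mul (B : Matrix ι κ ℝ) : (Bᵀ * B).PosSemidef := by
  simpa using Matrix.posSemidef_conjTranspose_mul_self B

theorem isClosed_setOf_posSemidef : IsClosed {Z : Matrix ι ι ℝ | Z.PosSemidef} := by
  have h : {Z : Matrix ι ι ℝ | Z.PosSemidef} =
      {Z | Zᴴ = Z} ∩ ⋂ x : ι → ℝ, {Z | 0 ≤ star x ⬝ᵥ (Z *ᵥ x)} := by
    ext Z
    simp [Matrix.posSemidef_iff_dotProduct_mulVec, Matrix.IsHermitian]
  rw [h]
  refine (isClosed_eq (by fun_prop) (by fun_prop)).inter (isClosed_iInter fun x =>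
    isClosed_le (by fun_prop) ?_)
  exact Continuous.dotProduct continuous_const
    (Continuous.matrix_mulVec continuous_id continuous_const)

/-- With the correction `R Z = A Z Aᵀ` the Euler step becomes `(1 + hA) Z (1 + hA)ᵀ + (h/γ²) ∑ N k Z
(N k)ᵀ`, visibly positive semidefinite. -/
theorem posSemidef_flow (A : Matrix ι ι ℝ) (N : Fin m → Matrix ι ι ℝ) (γ : ℝ) {Z : Matrix ι ι ℝ}
    (hZ : Z.PosSemidef) {t : ℝ} (ht : 0 ≤ t) : (flow (lyapCLM A N γ) t Z).PosSemidef := by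
  refine flow_mem_cone (C := {Z : Matrix ι ι ℝ | Z.PosSemidef}) isClosed_setOf_posSemidef
    Matrix.PosSemidef.zero (fun _ h _ h' => Matrix.PosSemidef.add h h')
    (fun c hc _ h => Matrix.PosSemidef.smul h hc)
    -- The second operator is `Z ↦ A Z Aᵀ`, written as a Sylvester operator with zero drift, one
    -- noise term and `γ = 1`.
    (lyapCLM A N γ) (sylvCLM 0 (fun _ : Fin 1 => A) 0 (fun _ => A) 1)
    (fun h hh W hW => ?_) t ht Z hZ
  have h1 : W + h • lyapCLM A N γ W + h ^ 2 • sylvCLM 0 (fun _ : Fin 1 => A) 0 (fun _ => A) 1 W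
      = (1 + h • A) * W * (1 + h • A)ᵀ + (h * (1 / γ ^ 2)) • ∑ k, N k * W * (N k)ᵀ := by
    simp only [sylvCLM_apply, sylvOp]
    simp [Matrix.add_mul, Matrix.mul_add, smul_smul, pow_two]
    abel
  rw [mem_ofPred_eq, h1]
  refine (posSemidef_mul_mul_transpose hW _).add (Matrix.PosSemidef.smul ?_ (by positivity))
  exact Matrix.posSemidef_sum _ fun k _ => posSemidef_mul_mul_transpose hW _

theorem IsLyapFlow.eq_flow {A : Matrix ι ι ℝ} {N : Fin m → Matrix ι ι ℝ} {γ : ℝ}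
    {K : Matrix ι ι ℝ} {Z : ℝ → Matrix ι ι ℝ} (h : IsLyapFlow A N γ K Z) {t : ℝ} (ht : 0 ≤ t) :
    Z t = flow (lyapCLM A N γ) t K := by
  rw [← h.1]
  exact BilinearMOR.eq_flow (lyapCLM A N γ) Z
    (fun t ht => hasDerivWithinAt_matrix_iff.2 fun i j => h.2 t ht i j) t ht

theorem isLyapFlow_flow (A : Matrix ι ι ℝ) (N : Fin m → Matrix ι ι ℝ) (γ : ℝ) (K : Matrix ι ι ℝ) :
    IsLyapFlow A N γ K (fun t => flow (lyapCLM A N γ) t K) :=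
  ⟨flow_zero _ _, fun t _ => hasDerivWithinAt_matrix_iff.1
    (hasDerivAt_flow (lyapCLM A N γ) K t).hasDerivWithinAt⟩

/-- Uniqueness for the differential equation replaces the unspecified solution by the exponential
flow, so everything about Gramians reduces to integrability of that flow. -/
theorem isGramian_iff {A : Matrix ι ι ℝ} {N : Fin m → Matrix ι ι ℝ} {γ : ℝ} {K P : Matrix ι ι ℝ} :
    IsGramian A N γ K P ↔ IntegrableOn (fun t => flow (lyapCLM A N γ) t K) (Ioi 0) ∧
      P = ∫ t in Ioi (0 : ℝ), flow (lyapCLM A N γ) t K := by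
  constructor
  · rintro ⟨Z, hZ, hP⟩
    have hi : IntegrableOn Z (Ioi 0) := integrable_matrix_iff.2 fun i j => (hP i j).1
    have he : EqOn Z (fun t => flow (lyapCLM A N γ) t K) (Ioi 0) :=
      fun t ht => hZ.eq_flow (le_of_lt ht)
    refine ⟨hi.congr_fun he measurableSet_Ioi, ?_⟩
    rw [← setIntegral_congr_fun measurableSet_Ioi he]
    ext i j
    rw [(hP i j).2, integral_matrix_apply hi]
  · rintro ⟨hi, rfl⟩
    exact ⟨_, isLyapFlow_flow A N γ K, fun i j => ⟨integrable_matrix_iff.1 hi i j,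
      integral_matrix_apply hi i j⟩⟩

theorem IsGramian.lyapOp_eq {A : Matrix ι ι ℝ} {N : Fin m → Matrix ι ι ℝ} {γ : ℝ}
    {K P : Matrix ι ι ℝ} (h : IsGramian A N γ K P) : lyapOp A N γ P = -K := by
  obtain ⟨hi, rfl⟩ := isGramian_iff.1 h
  exact map_integral_flow (lyapCLM A N γ) K hi

theorem IsGramian.diag_nonneg {A : Matrix ι ι ℝ} {N : Fin m → Matrix ι ι ℝ} {γ : ℝ}
    {K P : Matrix ι ι ℝ} (h : IsGramian A N γ K P) (hK : K.PosSemidef) (i : ι) : 0 ≤ P i i := by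
  obtain ⟨hi, rfl⟩ := isGramian_iff.1 h
  rw [integral_matrix_apply hi]
  exact setIntegral_nonneg measurableSet_Ioi fun t ht =>
    (posSemidef_flow A N γ hK (le_of_lt ht)).diag_nonneg

theorem IsGramian.existsUnique {A : Matrix ι ι ℝ} {N : Fin m → Matrix ι ι ℝ} {γ : ℝ}
    {K P : Matrix ι ι ℝ} (h : IsGramian A N γ K P) : ∃! P, IsGramian A N γ K P := by
  refine ⟨P, h, fun P' h' => ?_⟩
  rw [(isGramian_iff.1 h).2, (isGramian_iff.1 h').2]

/-- Multiplication from the left and from the right. -/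
def mulMulCLM {ι' κ' : Type} [Fintype ι'] [Fintype κ'] (S : Matrix ι' ι ℝ) (U : Matrix κ κ' ℝ) :
    Matrix ι κ ℝ →L[ℝ] Matrix ι' κ' ℝ :=
  LinearMap.toContinuousLinearMap
    { toFun := fun Z => S * Z * U
      map_add' := fun X Y => by simp only [Matrix.mul_add, Matrix.add_mul]
      map_smul' := fun c X => by simp only [Matrix.mul_smul, Matrix.smul_mul, RingHom.id_apply] }

@[simp] theorem mulMulCLM_apply {ι' κ' : Type} [Fintype ι'] [Fintype κ'] (S : Matrix ι' ι ℝ)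
    (U : Matrix κ κ' ℝ) (Z : Matrix ι κ ℝ) : mulMulCLM S U Z = S * Z * U := rfl

/-- Flows of generalized Sylvester operators are compatible with intertwined coefficients. -/
theorem flow_semiconj {ι' κ' : Type} [Fintype ι'] [DecidableEq ι'] [Fintype κ'] [DecidableEq κ']
    {A : Matrix ι ι ℝ} {N : Fin m → Matrix ι ι ℝ} {B : Matrix κ κ ℝ} {M : Fin m → Matrix κ κ ℝ}
    {A' : Matrix ι' ι' ℝ} {N' : Fin m → Matrix ι' ι' ℝ} {B' : Matrix κ' κ' ℝ}
    {M' : Fin m → Matrix κ' κ' ℝ} {P : Matrix ι' ι ℝ} {Q : Matrix κ' κ ℝ}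
    (hA : P * A = A' * P) (hN : ∀ k, P * N k = N' k * P)
    (hB : Q * B = B' * Q) (hM : ∀ k, Q * M k = M' k * Q) (γ t : ℝ) (Z : Matrix ι κ ℝ) :
    P * flow (sylvCLM A N B M γ) t Z * Qᵀ = flow (sylvCLM A' N' B' M' γ) t (P * Z * Qᵀ) := by
  refine flow_intertwine (sylvCLM A N B M γ) (sylvCLM A' N' B' M' γ) (mulMulCLM P Qᵀ)
    (fun Z => ?_) t Z
  have h1 : Bᵀ * Qᵀ = Qᵀ * B'ᵀ := by rw [← Matrix.transpose_mul, hB, Matrix.transpose_mul]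
  have h2 : ∀ k, (M k)ᵀ * Qᵀ = Qᵀ * (M' k)ᵀ := fun k => by
    rw [← Matrix.transpose_mul, hM, Matrix.transpose_mul]
  simp only [sylvCLM_apply, mulMulCLM_apply, sylvOp, Matrix.mul_add, Matrix.add_mul,
    Matrix.mul_smul, Matrix.smul_mul, Matrix.mul_sum, Matrix.sum_mul]
  simp only [← Matrix.mul_assoc, hA, hN]
  simp only [Matrix.mul_assoc, h1, h2]

/-- A change of the state coordinates transforms Gramians by congruence. -/
theorem IsGramian.congr_transform {A : Matrix ι ι ℝ} {N : Fin m → Matrix ι ι ℝ} {γ : ℝ}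
    {K P : Matrix ι ι ℝ} (h : IsGramian A N γ K P) (S : Matrix κ ι ℝ) (T : Matrix ι κ ℝ)
    (hTS : T * S = 1) :
    IsGramian (S * A * T) (fun k => S * N k * T) γ (S * K * Sᵀ) (S * P * Sᵀ) := by
  obtain ⟨hi, rfl⟩ := isGramian_iff.1 h
  have hS : ∀ B : Matrix ι ι ℝ, S * B = S * B * T * S := fun B => by
    rw [Matrix.mul_assoc _ T, hTS, Matrix.mul_one]
  have he := fun t => flow_semiconj (hS A) (fun k => hS (N k)) (hS A) (fun k => hS (N k)) γ t K
  refine isGramian_iff.2 ⟨?_, ?_⟩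
  · exact ((mulMulCLM S Sᵀ).integrable_comp hi).congr (Eventually.of_forall he)
  · simp_rw [← he]
    exact ((mulMulCLM S Sᵀ).integral_comp_comm hi).symm

/-- The trace pairing `(X, Y) ↦ tr (X Y)`. -/
def tracePairing : Matrix ι κ ℝ →L[ℝ] Matrix κ ι ℝ →L[ℝ] ℝ :=
  LinearMap.toContinuousBilinearMap
    (LinearMap.mk₂ ℝ (fun X Y => (X * Y).trace)
      (fun X X' Y => by rw [Matrix.add_mul, Matrix.trace_add])
      (fun c X Y => by rw [Matrix.smul_mul, Matrix.trace_smul])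
      (fun X Y Y' => by rw [Matrix.mul_add, Matrix.trace_add])
      (fun c X Y => by rw [Matrix.mul_smul, Matrix.trace_smul]))

@[simp] theorem tracePairing_apply (X : Matrix ι κ ℝ) (Y : Matrix κ ι ℝ) :
    tracePairing X Y = (X * Y).trace := rfl

theorem trace_lyapOp_mul (A : Matrix ι ι ℝ) (N : Fin m → Matrix ι ι ℝ) (γ : ℝ)
    (X Y : Matrix ι ι ℝ) :
    (lyapOp Aᵀ (fun k => (N k)ᵀ) γ X * Y).trace = (X * lyapOp A N γ Y).trace := by
  have h : ∀ B : Matrix ι ι ℝ, (Bᵀ * X * B * Y).trace = (X * (B * Y * Bᵀ)).trace := fun B => by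
    rw [Matrix.mul_assoc, Matrix.mul_assoc, Matrix.trace_mul_comm]
    simp only [Matrix.mul_assoc]
  simp only [lyapOp, sylvOp, Matrix.add_mul, Matrix.mul_add, Matrix.trace_add,
    Matrix.transpose_transpose, Matrix.smul_mul, Matrix.mul_smul, Matrix.trace_smul,
    Matrix.sum_mul, Matrix.mul_sum, Matrix.trace_sum, h]
  rw [Matrix.mul_assoc, Matrix.trace_mul_comm Aᵀ]
  simp only [Matrix.mul_assoc]
  ring

theorem trace_flow_mul (A : Matrix ι ι ℝ) (N : Fin m → Matrix ι ι ℝ) (γ : ℝ)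
    (X Y : Matrix ι ι ℝ) (t : ℝ) :
    (flow (lyapCLM Aᵀ (fun k => (N k)ᵀ) γ) t X * Y).trace =
      (X * flow (lyapCLM A N γ) t Y).trace :=
  flow_dual (lyapCLM Aᵀ (fun k => (N k)ᵀ) γ) (lyapCLM A N γ) tracePairing
    (fun X Y => trace_lyapOp_mul A N γ X Y) t X Y

end matrix

/-! ### Stability, integrability and boundedness of Lyapunov flows -/

section matrix

variable {m p q : ℕ} {ι κ : Type} [Fintype ι] [DecidableEq ι] [Fintype κ] [DecidableEq κ]

/-- The vectorization of a real matrix, as a complex vector. -/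
def complexVec : Matrix ι ι ℝ →L[ℝ] (ι × ι → ℂ) :=
  LinearMap.toContinuousLinearMap
    { toFun := fun Z p => (Z.vec p : ℂ)
      map_add' := fun X Y => by ext; simp
      map_smul' := fun c X => by ext; simp }

theorem kronMatrix_mulVec_vec (sys : HomSystem m p q ι) (γ : ℝ) (Z : Matrix ι ι ℝ) :
    sys.kronMatrix γ *ᵥ Z.vec = (lyapOp sys.A sys.N γ Z).vec := by
  simp only [HomSystem.kronMatrix, lyapOp, sylvOp, Matrix.add_mulVec, Matrix.smul_mulVec,
    Matrix.sum_mulVec, Matrix.kronecker_mulVec_vec, Matrix.vec_add, Matrix.vec_smul, Matrix.vec_sum,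
    Matrix.one_mul, Matrix.mul_one, Matrix.transpose_one]
  abel_nf

/-- Vectorization turns the Lyapunov operator into the Kronecker matrix, and at integer times the
flow is a power of one exponential. Decay along the integers is enough for `sylvOp_injective`. -/
theorem tendsto_flow_of_isStable (sys : HomSystem m p q ι) {γ : ℝ} (h : sys.IsStable γ)
    (Z : Matrix ι ι ℝ) (i j : ι) :
    Tendsto (fun n : ℕ => flow (lyapCLM sys.A sys.N γ) n Z i j) atTop (𝓝 0) := by
  set K := (sys.kronMatrix γ).map (algebraMap ℝ ℂ) with hK
  set f : (ι × ι → ℂ) →L[ℂ] (ι × ι → ℂ) := LinearMap.toContinuousLinearMap K.toLin' with hf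
  set L := lyapCLM sys.A sys.N γ
  have hint : ∀ X, complexVec (L X) = f (complexVec X) := by
    intro X
    ext p
    have h1 := RingHom.map_mulVec (algebraMap ℝ ℂ) (sys.kronMatrix γ) X.vec p
    rw [kronMatrix_mulVec_vec] at h1
    exact h1
  have hpow : ∀ n : ℕ, complexVec (flow L n Z) = (exp f ^ n) (complexVec Z) := by
    intro n
    let _ : NormedAlgebra ℚ (Matrix ι ι ℝ →L[ℝ] Matrix ι ι ℝ) := NormedAlgebra.restrictScalars ℚ ℝ _
    have h1 : flow L n Z = (exp L ^ n) Z := by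
      rw [flow, ← exp_nsmul, Nat.cast_smul_eq_nsmul]
    rw [h1]
    clear h1
    induction n with
    | zero => simp
    | succ n ih =>
      rw [pow_succ', pow_succ', mul_apply_eq_comp, mul_apply_eq_comp, ← ih]
      exact exp_intertwine L f complexVec hint _
  have hlim := tendsto_exp_pow_apply f (fun z hz => by
    have h1 := Module.End.hasEigenvalue_iff_mem_spectrum.1 hz
    have h2 : z ∈ spectrum ℂ K := by
      rw [← Matrix.spectrum_toLin']; exact h1
    exact h h2) (complexVec Z)
  simp_rw [← hpow] at hlim
  -- `Matrix.vec` stacks columns, hence the swapped indices.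
  have h1 := tendsto_pi_nhds.1 hlim (j, i)
  have h2 := (Complex.continuous_re.tendsto _).comp h1
  exact h2

/-- The form is nonnegative at `x eₐ + e_b` for every `x`, so this quadratic polynomial in `x` has
nonpositive discriminant. -/
theorem sq_apply_le_of_posSemidef {F : Matrix ι ι ℝ} (hF : F.PosSemidef) (a b : ι) :
    F a b ^ 2 ≤ F a a * F b b := by
  have hs : F b a = F a b := by simpa using hF.isHermitian.apply a b
  have h : ∀ x : ℝ, 0 ≤ F a a * (x * x) + 2 * F a b * x + F b b := by
    intro x
    have := hF.dotProduct_mulVec_nonneg (x • Pi.single a 1 + Pi.single b 1)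
    simp [Matrix.mulVec_add, Matrix.mulVec_smul, add_dotProduct, dotProduct_add, hs] at this
    linarith
  have := discrim_le_zero h
  rw [discrim] at this
  linarith

theorem abs_apply_le_of_posSemidef {F : Matrix ι ι ℝ} (hF : F.PosSemidef) (a b : ι) :
    |F a b| ≤ F a a + F b b := by
  have h := sq_apply_le_of_posSemidef hF a b
  have ha := hF.diag_nonneg (i := a)
  have hb := hF.diag_nonneg (i := b)
  refine abs_le_of_sq_le_sq (by nlinarith) (by positivity)

theorem integrableOn_flow_of_diag (A : Matrix ι ι ℝ) (N : Fin m → Matrix ι ι ℝ) (γ : ℝ)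
    {K : Matrix ι ι ℝ} (hK : K.PosSemidef)
    (h : ∀ i, IntegrableOn (fun t => flow (lyapCLM A N γ) t K i i) (Ioi 0)) :
    IntegrableOn (fun t => flow (lyapCLM A N γ) t K) (Ioi 0) := by
  refine integrable_matrix_iff.2 fun i j => ?_
  refine Integrable.mono' ((h i).add (h j)) ?_ ?_
  · exact ((entryCLM i j).continuous.comp (continuous_flow _ K)).aestronglyMeasurable
  · refine (ae_restrict_mem measurableSet_Ioi).mono fun t ht => ?_
    exact abs_apply_le_of_posSemidef (posSemidef_flow A N γ hK (le_of_lt ht)) i j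

/-- A nonnegative solution of a Lyapunov inequality gives the existence of the Gramian. -/
theorem integrableOn_flow_of_lyapOp (A : Matrix ι ι ℝ) (N : Fin m → Matrix ι ι ℝ) (γ : ℝ)
    {K R D : Matrix ι ι ℝ} (hK : K.PosSemidef) (hR : R.PosSemidef) (hD : D.PosSemidef)
    (h : lyapOp A N γ D = -(K + R)) :
    IntegrableOn (fun t => flow (lyapCLM A N γ) t K) (Ioi 0) := by
  set L := lyapCLM A N γ
  refine integrableOn_flow_of_diag A N γ hK fun i => ?_
  have hc : ∀ Z, Continuous fun t => flow L t Z i i := fun Z =>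
    (entryCLM i i).continuous.comp (continuous_flow L Z)
  refine integrableOn_Ioi_of_intervalIntegral_norm_bounded (l := atTop) (b := fun x : ℝ => x)
    (D i i) 0 (fun b => ((hc K).intervalIntegrable 0 b).1) tendsto_id ?_
  filter_upwards [eventually_ge_atTop 0] with b hb
  -- The flow of `D` loses exactly the flows of `K` and `R`. As it stays nonnegative, `D i i` bounds
  -- all partial integrals of the flow of `K`.
  have hderiv : ∀ t ∈ uIcc 0 b, HasDerivAt (fun t => flow L t D i i)
      (-(flow L t K i i + flow L t R i i)) t := by
    intro t _
    have h1 := (entryCLM i i).hasFDerivAt.comp_hasDerivAt t (hasDerivAt_flow L D t)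
    rw [← flow_map, show L D = -(K + R) from h, flow_neg, flow_add] at h1
    exact h1
  have h2 := intervalIntegral.integral_eq_sub_of_hasDerivAt hderiv
    (((hc K).add (hc R)).neg.intervalIntegrable 0 b)
  rw [intervalIntegral.integral_neg, flow_zero] at h2
  have h3 := (posSemidef_flow A N γ hD hb).diag_nonneg (i := i)
  have h4 : ∫ t in (0:ℝ)..b, ‖flow L t K i i‖ ≤
      ∫ t in (0:ℝ)..b, (flow L t K i i + flow L t R i i) := by
    refine intervalIntegral.integral_mono_on hb ((hc K).norm.intervalIntegrable _ _)
      (((hc K).add (hc R)).intervalIntegrable _ _) fun t ht => ?_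
    have hk := (posSemidef_flow A N γ hK ht.1).diag_nonneg (i := i)
    have hr := (posSemidef_flow A N γ hR ht.1).diag_nonneg (i := i)
    rw [Real.norm_eq_abs]
    change 0 ≤ flow L t K i i at hk
    change 0 ≤ flow L t R i i at hr
    rw [abs_of_nonneg hk]
    linarith
  change 0 ≤ flow L b D i i at h3
  linarith

/-- If `tr (D Z(t))` does not increase for a positive diagonal matrix `D`, the flow is bounded. -/
theorem flow_diag_le_of_trace (A : Matrix ι ι ℝ) (N : Fin m → Matrix ι ι ℝ) (γ : ℝ) {d : ι → ℝ}
    (hd : ∀ i, 0 < d i)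
    (h : ∀ Z : Matrix ι ι ℝ, Z.PosSemidef → (Matrix.diagonal d * lyapOp A N γ Z).trace ≤ 0)
    {Z : Matrix ι ι ℝ} (hZ : Z.PosSemidef) {t : ℝ} (ht : 0 ≤ t) (i : ι) :
    flow (lyapCLM A N γ) t Z i i ≤ (Matrix.diagonal d * Z).trace / d i := by
  set L := lyapCLM A N γ
  have hderiv : ∀ t, HasDerivAt (fun t => tracePairing (Matrix.diagonal d) (flow L t Z))
      (Matrix.diagonal d * L (flow L t Z)).trace t := fun t =>
    (tracePairing (Matrix.diagonal d)).hasFDerivAt.comp_hasDerivAt t (hasDerivAt_flow L Z t)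
  have hanti : AntitoneOn (fun t => tracePairing (Matrix.diagonal d) (flow L t Z)) (Ici 0) := by
    refine antitoneOn_of_deriv_nonpos (convex_Ici 0)
      (fun t _ => (hderiv t).continuousAt.continuousWithinAt)
      (fun t _ => (hderiv t).differentiableAt.differentiableWithinAt) fun t ht => ?_
    rw [(hderiv t).deriv]
    exact h _ (posSemidef_flow A N γ hZ (by rw [interior_Ici] at ht; exact le_of_lt ht))
  have h1 := hanti (mem_Ici.2 le_rfl) (mem_Ici.2 ht) ht
  simp only [tracePairing_apply, flow_zero] at h1
  rw [le_div_iff₀ (hd i)]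
  refine le_trans ?_ h1
  rw [Matrix.trace]
  simp only [Matrix.diag_apply, Matrix.diagonal_mul]
  rw [mul_comm]
  exact Finset.single_le_sum (f := fun i => d i * flow L t Z i i)
    (fun j _ => mul_nonneg (hd j).le (posSemidef_flow A N γ hZ ht).diag_nonneg) (Finset.mem_univ i)

/-! ### The error system and the mixed Sylvester equation -/

/-- The block diagonal sum of two systems with the difference of the outputs as output. -/
def HomSystem.errorSystem (sys : HomSystem m p q ι) (red : HomSystem m p q κ) :
    HomSystem m p q (ι ⊕ κ) where
  A := Matrix.fromBlocks sys.A 0 0 red.A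
  N := fun k => Matrix.fromBlocks (sys.N k) 0 0 (red.N k)
  X₀ := Matrix.fromRows sys.X₀ red.X₀
  C := Matrix.fromCols sys.C (-red.C)

/-- The projection of a sum of coordinate spaces to the first summand. -/
def projLeft (ι κ : Type) [DecidableEq ι] : Matrix ι (ι ⊕ κ) ℝ := Matrix.fromCols 1 0

/-- The projection of a sum of coordinate spaces to the second summand. -/
def projRight (ι κ : Type) [DecidableEq κ] : Matrix κ (ι ⊕ κ) ℝ := Matrix.fromCols 0 1

theorem projLeft_mul_fromBlocks (A : Matrix ι ι ℝ) (B : Matrix κ κ ℝ) :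
    projLeft ι κ * Matrix.fromBlocks A 0 0 B = A * projLeft ι κ := by
  simp [projLeft, Matrix.fromCols_mul_fromBlocks, Matrix.mul_fromCols]

theorem projRight_mul_fromBlocks (A : Matrix ι ι ℝ) (B : Matrix κ κ ℝ) :
    projRight ι κ * Matrix.fromBlocks A 0 0 B = B * projRight ι κ := by
  simp [projRight, Matrix.fromCols_mul_fromBlocks, Matrix.mul_fromCols]

theorem projLeft_mul_mul_projLeft (F : Matrix (ι ⊕ κ) (ι ⊕ κ) ℝ) :
    projLeft ι κ * F * (projLeft ι κ)ᵀ = F.toBlocks₁₁ := by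
  conv_lhs => rw [← F.fromBlocks_toBlocks]
  simp [projLeft, Matrix.fromCols_mul_fromBlocks, Matrix.transpose_fromCols,
    Matrix.fromCols_mul_fromRows]

theorem projLeft_mul_mul_projRight (F : Matrix (ι ⊕ κ) (ι ⊕ κ) ℝ) :
    projLeft ι κ * F * (projRight ι κ)ᵀ = F.toBlocks₁₂ := by
  conv_lhs => rw [← F.fromBlocks_toBlocks]
  simp [projLeft, projRight, Matrix.fromCols_mul_fromBlocks, Matrix.transpose_fromCols,
    Matrix.fromCols_mul_fromRows]

theorem projRight_mul_mul_projRight (F : Matrix (ι ⊕ κ) (ι ⊕ κ) ℝ) :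
    projRight ι κ * F * (projRight ι κ)ᵀ = F.toBlocks₂₂ := by
  conv_lhs => rw [← F.fromBlocks_toBlocks]
  simp [projRight, Matrix.fromCols_mul_fromBlocks, Matrix.transpose_fromCols,
    Matrix.fromCols_mul_fromRows]

section blocks

variable (A : Matrix ι ι ℝ) (N : Fin m → Matrix ι ι ℝ) (B : Matrix κ κ ℝ)
  (M : Fin m → Matrix κ κ ℝ) (γ t : ℝ)

theorem toBlocks₁₁_flow (Z : Matrix (ι ⊕ κ) (ι ⊕ κ) ℝ) :
    (flow (lyapCLM (Matrix.fromBlocks A 0 0 B) (fun k => Matrix.fromBlocks (N k) 0 0 (M k)) γ)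
      t Z).toBlocks₁₁ = flow (lyapCLM A N γ) t Z.toBlocks₁₁ := by
  rw [← projLeft_mul_mul_projLeft, ← projLeft_mul_mul_projLeft]
  exact flow_semiconj (projLeft_mul_fromBlocks _ _) (fun _ => projLeft_mul_fromBlocks _ _)
    (projLeft_mul_fromBlocks _ _) (fun _ => projLeft_mul_fromBlocks _ _) γ t Z

theorem toBlocks₁₂_flow (Z : Matrix (ι ⊕ κ) (ι ⊕ κ) ℝ) :
    (flow (lyapCLM (Matrix.fromBlocks A 0 0 B) (fun k => Matrix.fromBlocks (N k) 0 0 (M k)) γ)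
      t Z).toBlocks₁₂ = flow (sylvCLM A N B M γ) t Z.toBlocks₁₂ := by
  rw [← projLeft_mul_mul_projRight, ← projLeft_mul_mul_projRight]
  exact flow_semiconj (projLeft_mul_fromBlocks _ _) (fun _ => projLeft_mul_fromBlocks _ _)
    (projRight_mul_fromBlocks _ _) (fun _ => projRight_mul_fromBlocks _ _) γ t Z

theorem toBlocks₂₂_flow (Z : Matrix (ι ⊕ κ) (ι ⊕ κ) ℝ) :
    (flow (lyapCLM (Matrix.fromBlocks A 0 0 B) (fun k => Matrix.fromBlocks (N k) 0 0 (M k)) γ)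
      t Z).toBlocks₂₂ = flow (lyapCLM B M γ) t Z.toBlocks₂₂ := by
  rw [← projRight_mul_mul_projRight, ← projRight_mul_mul_projRight]
  exact flow_semiconj (projRight_mul_fromBlocks _ _) (fun _ => projRight_mul_fromBlocks _ _)
    (projRight_mul_fromBlocks _ _) (fun _ => projRight_mul_fromBlocks _ _) γ t Z

end blocks

theorem fromRows_mul_transpose {q : Type} [Fintype q] (X : Matrix ι q ℝ) (Y : Matrix κ q ℝ) :
    Matrix.fromRows X Y * (Matrix.fromRows X Y)ᵀ =
      Matrix.fromBlocks (X * Xᵀ) (X * Yᵀ) (Y * Xᵀ) (Y * Yᵀ) := by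
  simp [Matrix.transpose_fromRows]

/-- A kernel element is a fixed point of the mixed flow and sits as an off-diagonal block in a
positive semidefinite flow. The 2×2 minors bound its squared entries by a decaying entry times a
bounded one; the second flow need not decay. -/
theorem sylvOp_injective {A : Matrix ι ι ℝ} {N : Fin m → Matrix ι ι ℝ} {B : Matrix κ κ ℝ}
    {M : Fin m → Matrix κ κ ℝ} {γ : ℝ}
    (hA : ∀ Z i j, Tendsto (fun n : ℕ => flow (lyapCLM A N γ) n Z i j) atTop (𝓝 0))
    (hB : ∀ Z : Matrix κ κ ℝ, Z.PosSemidef → ∀ j, ∃ c, ∀ t, 0 ≤ t →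
      flow (lyapCLM B M γ) t Z j j ≤ c)
    {Y : Matrix ι κ ℝ} (hY : sylvOp A N B M γ Y = 0) : Y = 0 := by
  have hconst : ∀ t, 0 ≤ t → flow (sylvCLM A N B M γ) t Y = Y := fun t ht =>
    (eq_flow (sylvCLM A N B M γ) (fun _ => Y) (fun t _ => by
      rw [show sylvCLM A N B M γ Y = 0 from hY]; exact hasDerivWithinAt_const _ _ _) t ht).symm
  -- This is `(Y; 1) (Y; 1)ᵀ`, an initial value with off-diagonal block `Y`.
  have hinit : (Matrix.fromBlocks (Y * Yᵀ) Y Yᵀ 1).PosSemidef := by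
    have h := posSemidef_mul_transpose (Matrix.fromRows Y (1 : Matrix κ κ ℝ))
    rwa [fromRows_mul_transpose, Matrix.transpose_one, Matrix.mul_one, Matrix.mul_one,
      Matrix.one_mul] at h
  ext i j
  obtain ⟨c, hc⟩ := hB 1 Matrix.PosSemidef.one j
  have hle : ∀ n : ℕ, Y i j ^ 2 ≤ flow (lyapCLM A N γ) n (Y * Yᵀ) i i * |c| := by
    intro n
    have hn : (0 : ℝ) ≤ n := Nat.cast_nonneg n
    have hpsd := posSemidef_flow (Matrix.fromBlocks A 0 0 B)
      (fun k => Matrix.fromBlocks (N k) 0 0 (M k)) γ hinit hn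
    have h := sq_apply_le_of_posSemidef hpsd (Sum.inl i) (Sum.inr j)
    have h11 := congrFun₂ (toBlocks₁₁_flow A N B M γ n (Matrix.fromBlocks (Y * Yᵀ) Y Yᵀ 1)) i i
    have h12 := congrFun₂ (toBlocks₁₂_flow A N B M γ n (Matrix.fromBlocks (Y * Yᵀ) Y Yᵀ 1)) i j
    have h22 := congrFun₂ (toBlocks₂₂_flow A N B M γ n (Matrix.fromBlocks (Y * Yᵀ) Y Yᵀ 1)) j j
    have hd := hpsd.diag_nonneg (i := Sum.inl i)
    rw [Matrix.toBlocks_fromBlocks₁₁] at h11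
    rw [Matrix.toBlocks_fromBlocks₁₂, hconst n hn] at h12
    rw [Matrix.toBlocks_fromBlocks₂₂] at h22
    rw [Matrix.toBlocks₁₁, Matrix.of_apply] at h11
    rw [Matrix.toBlocks₁₂, Matrix.of_apply] at h12
    rw [Matrix.toBlocks₂₂, Matrix.of_apply] at h22
    rw [h11] at hd
    rw [h11, h12, h22] at h
    exact h.trans (mul_le_mul_of_nonneg_left ((hc n hn).trans (le_abs_self c)) hd)
  have hlim : Tendsto (fun n : ℕ => flow (lyapCLM A N γ) n (Y * Yᵀ) i i * |c|) atTop (𝓝 0) := by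
    simpa using (hA (Y * Yᵀ) i i).mul_const |c|
  have := ge_of_tendsto' hlim hle
  simpa using le_antisymm this (sq_nonneg _)

theorem existsUnique_sylvOp_eq {A : Matrix ι ι ℝ} {N : Fin m → Matrix ι ι ℝ} {B : Matrix κ κ ℝ}
    {M : Fin m → Matrix κ κ ℝ} {γ : ℝ} (h : ∀ Y, sylvOp A N B M γ Y = 0 → Y = 0)
    (R : Matrix ι κ ℝ) : ∃! Y, sylvOp A N B M γ Y = R := by
  have hinj : Function.Injective (sylvCLM A N B M γ : Matrix ι κ ℝ →ₗ[ℝ] Matrix ι κ ℝ) :=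
    (injective_iff_map_eq_zero _).2 h
  obtain ⟨Y, hY⟩ := LinearMap.surjective_of_injective hinj R
  exact ⟨Y, hY, fun Y' hY' => hinj (hY'.trans hY.symm)⟩

/-- The diagonal blocks of the error flow are the two given flows, and positivity dominates
off-diagonal entries by diagonal ones. So the mixed block is integrable too, and its integral solves
the mixed equation. -/
theorem HomSystem.IsGramianP.errorSystem {sys : HomSystem m p q ι} {red : HomSystem m p q κ}
    {γ : ℝ} {P : Matrix ι ι ℝ} {Pr : Matrix κ κ ℝ} (hP : sys.IsGramianP γ P)
    (hPr : red.IsGramianP γ Pr) :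
    ∃ Pe, (sys.errorSystem red).IsGramianP γ Pe ∧ Pe.toBlocks₁₁ = P ∧ Pe.toBlocks₂₂ = Pr ∧
      sylvOp sys.A sys.N red.A red.N γ Pe.toBlocks₁₂ = -(sys.X₀ * red.X₀ᵀ) := by
  have hP' := isGramian_iff.1 hP
  have hPr' := isGramian_iff.1 hPr
  set e := sys.errorSystem red
  set F := fun t => flow (lyapCLM e.A e.N γ) t (e.X₀ * e.X₀ᵀ) with hF
  have hblocks : e.X₀ * e.X₀ᵀ = _ := fromRows_mul_transpose sys.X₀ red.X₀
  have h11 : ∀ t, (F t).toBlocks₁₁ = flow (lyapCLM sys.A sys.N γ) t (sys.X₀ * sys.X₀ᵀ) := by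
    intro t
    have := toBlocks₁₁_flow sys.A sys.N red.A red.N γ t (e.X₀ * e.X₀ᵀ)
    rwa [hblocks, Matrix.toBlocks_fromBlocks₁₁, ← hblocks] at this
  have h12 : ∀ t, (F t).toBlocks₁₂ =
      flow (sylvCLM sys.A sys.N red.A red.N γ) t (sys.X₀ * red.X₀ᵀ) := by
    intro t
    have := toBlocks₁₂_flow sys.A sys.N red.A red.N γ t (e.X₀ * e.X₀ᵀ)
    rwa [hblocks, Matrix.toBlocks_fromBlocks₁₂, ← hblocks] at this
  have h22 : ∀ t, (F t).toBlocks₂₂ = flow (lyapCLM red.A red.N γ) t (red.X₀ * red.X₀ᵀ) := by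
    intro t
    have := toBlocks₂₂_flow sys.A sys.N red.A red.N γ t (e.X₀ * e.X₀ᵀ)
    rwa [hblocks, Matrix.toBlocks_fromBlocks₂₂, ← hblocks] at this
  have hi : IntegrableOn F (Ioi 0) := by
    refine integrableOn_flow_of_diag e.A e.N γ (posSemidef_mul_transpose _) ?_
    rintro (i | i)
    · exact (integrable_matrix_iff.1 hP'.1 i i).congr
        (Eventually.of_forall fun t => (congrFun₂ (h11 t) i i).symm)
    · exact (integrable_matrix_iff.1 hPr'.1 i i).congr
        (Eventually.of_forall fun t => (congrFun₂ (h22 t) i i).symm)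
  have hPL := (mulMulCLM (projLeft ι κ) (projLeft ι κ)ᵀ).integral_comp_comm hi
  have hPM := (mulMulCLM (projLeft ι κ) (projRight ι κ)ᵀ).integral_comp_comm hi
  have hPM' := (mulMulCLM (projLeft ι κ) (projRight ι κ)ᵀ).integrable_comp hi
  have hPR := (mulMulCLM (projRight ι κ) (projRight ι κ)ᵀ).integral_comp_comm hi
  simp only [mulMulCLM_apply, projLeft_mul_mul_projLeft, projLeft_mul_mul_projRight,
    projRight_mul_mul_projRight, h11, h12, h22] at hPL hPM hPM' hPR
  refine ⟨∫ t in Ioi (0 : ℝ), F t, isGramian_iff.2 ⟨hi, rfl⟩, ?_, ?_, ?_⟩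
  · rw [← hPL, hP'.2]
  · rw [← hPR, hPr'.2]
  · rw [← hPM]
    exact map_integral_flow (sylvCLM sys.A sys.N red.A red.N γ) _ hPM'

end matrix

/-! ### Monotonicity of absolutely continuous functions -/

section absolutelyContinuous

theorem absolutelyContinuousOnInterval_const (c a b : ℝ) :
    AbsolutelyContinuousOnInterval (fun _ : ℝ => c) a b :=
  ContDiffOn.absolutelyContinuousOnInterval contDiffOn_const

theorem absolutelyContinuousOnInterval_finset_sum {α : Type*} (s : Finset α) {f : α → ℝ → ℝ}
    {a b : ℝ} (h : ∀ i ∈ s, AbsolutelyContinuousOnInterval (f i) a b) :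
    AbsolutelyContinuousOnInterval (fun t => ∑ i ∈ s, f i t) a b := by
  classical
  induction s using Finset.induction_on with
  | empty => simpa using absolutelyContinuousOnInterval_const 0 a b
  | insert i s hi ih =>
    simp only [Finset.sum_insert hi]
    exact (h i (Finset.mem_insert_self i s)).fun_add
      (ih fun j hj => h j (Finset.mem_insert_of_mem hj))

/-- The exponential is 1-Lipschitz on the nonpositive half-line. This treats the factor `exp (-∫ γ²
‖u‖²)`, whose exponent is only absolutely continuous for an `L²` control. -/
theorem absolutelyContinuousOnInterval_exp_of_nonpos {f : ℝ → ℝ} {a b : ℝ}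
    (hf : AbsolutelyContinuousOnInterval f a b) (h0 : ∀ t ∈ uIcc a b, f t ≤ 0) :
    AbsolutelyContinuousOnInterval (fun t => Real.exp (f t)) a b := by
  have hlip : ∀ x y : ℝ, x ≤ 0 → y ≤ 0 → dist (Real.exp x) (Real.exp y) ≤ dist x y := by
    have key : ∀ x y : ℝ, x ≤ y → y ≤ 0 → dist (Real.exp x) (Real.exp y) ≤ dist x y := by
      intro x y hxy hy
      have h1 := Real.add_one_le_exp (x - y)
      have h2 : Real.exp x = Real.exp (x - y) * Real.exp y := by rw [← Real.exp_add]; ring_nf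
      have h3 := Real.exp_le_exp.2 hxy
      have h4 := Real.exp_le_one_iff.2 hy
      have h5 : Real.exp (x - y) ≤ 1 := Real.exp_le_one_iff.2 (by linarith)
      rw [Real.dist_eq, Real.dist_eq, abs_of_nonpos (by linarith), abs_of_nonpos (by linarith)]
      nlinarith [Real.exp_pos y]
    intro x y hx hy
    rcases le_total x y with h | h
    · exact key x y h hy
    · rw [dist_comm, dist_comm x]; exact key y x h hx
  rw [absolutelyContinuousOnInterval_iff] at hf ⊢
  intro ε hε
  obtain ⟨δ, hδ, H⟩ := hf ε hε
  refine ⟨δ, hδ, fun E hE hE' => lt_of_le_of_lt (Finset.sum_le_sum fun i hi => ?_) (H E hE hE')⟩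
  exact hlip _ _ (h0 _ (hE.1 i hi).1) (h0 _ (hE.1 i hi).2)

theorem le_of_absolutelyContinuousOnInterval {f : ℝ → ℝ} {a b : ℝ} (hab : a ≤ b)
    (hf : AbsolutelyContinuousOnInterval f a b)
    (h : ∀ᵐ t, t ∈ uIcc a b → deriv f t ≤ 0) : f b ≤ f a := by
  have h1 := hf.integral_deriv_eq_sub
  have h2 : ∫ t in a..b, deriv f t ≤ 0 := by
    rw [intervalIntegral.integral_of_le hab]
    refine integral_nonpos_of_ae ((ae_restrict_iff' measurableSet_Ioc).2 ?_)
    filter_upwards [h] with t ht ht'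
    exact ht (by rw [uIcc_of_le hab]; exact Ioc_subset_Icc_self ht')
  linarith

end absolutelyContinuous

/-! ### Pointwise output bound under a control -/

section control

variable {m p q : ℕ} {ι κ : Type} [Fintype ι] [DecidableEq ι] [Fintype κ] [DecidableEq κ]

theorem posSemidef_dotProduct_comm {F : Matrix ι ι ℝ} (hF : F.PosSemidef) (v w : ι → ℝ) :
    v ⬝ᵥ F *ᵥ w = w ⬝ᵥ F *ᵥ v := by
  rw [Matrix.dotProduct_mulVec, ← Matrix.mulVec_transpose, dotProduct_comm]
  congr 2
  simpa using hF.isHermitian.eq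

/-- The pointwise inequality behind the bound of the state by the flow of the Lyapunov operator. -/
theorem quadratic_form_deriv_le (A : Matrix ι ι ℝ) (N : Fin m → Matrix ι ι ℝ) {γ : ℝ} (hγ : 0 < γ)
    {F : Matrix ι ι ℝ} (hF : F.PosSemidef) (c : Fin m → ℝ) (w : ι → ℝ) :
    (A *ᵥ w + ∑ k, c k • N k *ᵥ w) ⬝ᵥ F *ᵥ w + w ⬝ᵥ F *ᵥ (A *ᵥ w + ∑ k, c k • N k *ᵥ w)
      - w ⬝ᵥ lyapOp Aᵀ (fun k => (N k)ᵀ) γ F *ᵥ w ≤ (γ ^ 2 * ∑ k, c k ^ 2) * (w ⬝ᵥ F *ᵥ w) := by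
  have h1 : w ⬝ᵥ lyapOp Aᵀ (fun k => (N k)ᵀ) γ F *ᵥ w =
      2 * ((A *ᵥ w) ⬝ᵥ F *ᵥ w) + 1 / γ ^ 2 * ∑ k, (N k *ᵥ w) ⬝ᵥ F *ᵥ (N k *ᵥ w) := by
    have hB : ∀ (B : Matrix ι ι ℝ) v, w ⬝ᵥ Bᵀ *ᵥ v = (B *ᵥ w) ⬝ᵥ v := fun B v => by
      rw [Matrix.dotProduct_mulVec, Matrix.vecMul_transpose]
    simp only [lyapOp, sylvOp, Matrix.add_mulVec, Matrix.smul_mulVec, Matrix.sum_mulVec,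
      dotProduct_add, dotProduct_smul, dotProduct_sum, ← Matrix.mulVec_mulVec, hB,
      Matrix.transpose_transpose, smul_eq_mul]
    rw [posSemidef_dotProduct_comm hF w (A *ᵥ w)]
    ring
  rw [posSemidef_dotProduct_comm hF w, h1]
  simp only [add_dotProduct, sum_dotProduct, smul_dotProduct, smul_eq_mul]
  have h2 : ∀ k, 2 * (c k * ((N k *ᵥ w) ⬝ᵥ F *ᵥ w)) ≤
      γ ^ 2 * c k ^ 2 * (w ⬝ᵥ F *ᵥ w) + 1 / γ ^ 2 * ((N k *ᵥ w) ⬝ᵥ F *ᵥ (N k *ᵥ w)) := by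
    intro k
    -- The vector is scaled so that the mixed term of the square is exactly `-2 c k` times the cross
    -- term, free of `γ`.
    have h := hF.dotProduct_mulVec_nonneg ((γ * c k) • w - γ⁻¹ • N k *ᵥ w)
    simp only [star_trivial, Matrix.mulVec_sub, Matrix.mulVec_smul, dotProduct_sub, sub_dotProduct,
      smul_dotProduct, dotProduct_smul, smul_eq_mul,
      posSemidef_dotProduct_comm hF w (N k *ᵥ w)] at h
    have h3 : γ * c k * (γ⁻¹ * ((N k *ᵥ w) ⬝ᵥ F *ᵥ w)) = c k * ((N k *ᵥ w) ⬝ᵥ F *ᵥ w) := by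
      field_simp
    have h4 : γ⁻¹ * (γ * c k * ((N k *ᵥ w) ⬝ᵥ F *ᵥ w)) = c k * ((N k *ᵥ w) ⬝ᵥ F *ᵥ w) := by
      field_simp
    have h5 : 1 / γ ^ 2 = γ⁻¹ * γ⁻¹ := by field_simp
    rw [h5]
    nlinarith
  have h6 := Finset.sum_le_sum fun k (_ : k ∈ Finset.univ) => h2 k
  rw [Finset.sum_add_distrib, ← Finset.mul_sum, ← Finset.sum_mul, ← Finset.mul_sum,
    ← Finset.mul_sum] at h6
  linarith

/-- Along the state, the form of the adjoint flow at the remaining time `T - t` grows at rate at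
most `γ² ∑ c k²`. Gronwall's argument runs almost everywhere, since the state is only absolutely
continuous. -/
theorem quadratic_form_state_le (A : Matrix ι ι ℝ) (N : Fin m → Matrix ι ι ℝ) {γ : ℝ} (hγ : 0 < γ)
    {K : Matrix ι ι ℝ} (hK : K.PosSemidef) {T : ℝ} (hT : 0 ≤ T) {c : ℝ → Fin m → ℝ}
    {w f : ℝ → ι → ℝ}
    (hc : IntervalIntegrable (fun t => γ ^ 2 * ∑ k, c t k ^ 2) volume 0 T)
    (hf : ∀ i, IntervalIntegrable (fun t => f t i) volume 0 T)
    (hfw : ∀ t ∈ Icc 0 T, f t = A *ᵥ w t + ∑ k, c t k • N k *ᵥ w t)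
    (hw : ∀ t ∈ Icc 0 T, ∀ i, w t i = w 0 i + ∫ τ in (0:ℝ)..t, f τ i) :
    w T ⬝ᵥ K *ᵥ w T ≤ Real.exp (∫ t in (0:ℝ)..T, γ ^ 2 * ∑ k, c t k ^ 2) *
      (w 0 ⬝ᵥ flow (lyapCLM Aᵀ (fun k => (N k)ᵀ) γ) T K *ᵥ w 0) := by
  set L := lyapCLM Aᵀ (fun k => (N k)ᵀ) γ
  set b := fun t => γ ^ 2 * ∑ k, c t k ^ 2 with hb
  set β := fun t => ∫ τ in (0:ℝ)..t, b τ with hβ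
  -- `W` equals `w` on `[0, T]`, but as a primitive it is differentiable at almost every point
  -- there, endpoints included.
  set W : ι → ℝ → ℝ := fun i t => w 0 i + ∫ τ in (0:ℝ)..t, f τ i with hW
  set φ : ι → ι → ℝ → ℝ := fun i j t => flow L (T - t) K i j with hφ
  have h0T : (0:ℝ) ∈ uIcc 0 T := left_mem_uIcc
  have hWd : ∀ᵐ t, t ∈ uIcc 0 T → ∀ i, HasDerivAt (W i) (f t i) t := by
    have := ae_all_iff.2 fun i => (hf i).ae_hasDerivAt_integral
    filter_upwards [this] with t ht htT i
    exact (ht i htT 0 h0T).const_add _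
  have hβd : ∀ᵐ t, t ∈ uIcc 0 T → HasDerivAt β (b t) t := by
    filter_upwards [hc.ae_hasDerivAt_integral] with t ht htT
    exact ht htT 0 h0T
  have hφd : ∀ i j t, HasDerivAt (φ i j) (-(L (flow L (T - t) K) i j)) t := by
    intro i j t
    have h1 := (hasDerivAt_flow L K (T - t)).scomp t ((hasDerivAt_id t).const_sub T)
    have h2 := (entryCLM i j).hasFDerivAt.comp_hasDerivAt t h1
    have h3 : entryCLM i j ((-1 : ℝ) • L (flow L (T - t) K)) = -(L (flow L (T - t) K) i j) := by
      rw [neg_one_smul, map_neg, entryCLM_apply]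
    rw [h3] at h2
    exact h2
  have hWac : ∀ i, AbsolutelyContinuousOnInterval (W i) 0 T := fun i =>
    (absolutelyContinuousOnInterval_const _ _ _).fun_add
      ((hf i).absolutelyContinuousOnInterval_intervalIntegral h0T)
  have hφac : ∀ i j, AbsolutelyContinuousOnInterval (φ i j) 0 T := by
    intro i j
    refine (ContDiff.contDiffOn ?_).absolutelyContinuousOnInterval
    rw [contDiff_one_iff_deriv]
    refine ⟨fun t => (hφd i j t).differentiableAt, ?_⟩
    have : deriv (φ i j) = fun t => -(entryCLM i j (L (flow L (T - t) K))) :=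
      funext fun t => (hφd i j t).deriv
    rw [this]
    exact ((entryCLM i j).continuous.comp (L.continuous.comp
      ((continuous_flow L K).comp (continuous_const.sub continuous_id)))).neg
  have hb0 : ∀ t, 0 ≤ b t := fun t => by
    rw [hb]; positivity
  have hβ0 : ∀ t ∈ uIcc 0 T, -β t ≤ 0 := by
    intro t ht
    rw [uIcc_of_le hT] at ht
    rw [neg_nonpos]
    exact intervalIntegral.integral_nonneg ht.1 fun τ _ => hb0 τ
  have hgac : AbsolutelyContinuousOnInterval (fun t => Real.exp (-β t)) 0 T :=
    absolutelyContinuousOnInterval_exp_of_nonpos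
      (hc.absolutelyContinuousOnInterval_intervalIntegral h0T).fun_neg hβ0
  set h := fun t => Real.exp (-β t) * ∑ i, ∑ j, W i t * W j t * φ i j t with hh
  have hhac : AbsolutelyContinuousOnInterval h 0 T := by
    refine hgac.fun_mul (absolutelyContinuousOnInterval_finset_sum _ fun i _ =>
      absolutelyContinuousOnInterval_finset_sum _ fun j _ => ?_)
    exact ((hWac i).fun_mul (hWac j)).fun_mul (hφac i j)
  have hquad : ∀ (F : Matrix ι ι ℝ) (v v' : ι → ℝ),
      v ⬝ᵥ F *ᵥ v' = ∑ i, ∑ j, v i * v' j * F i j := by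
    intro F v v'
    simp only [dotProduct, Matrix.mulVec, Finset.mul_sum]
    exact Finset.sum_congr rfl fun i _ => Finset.sum_congr rfl fun j _ => by ring
  have hhd : ∀ᵐ t, t ∈ uIcc 0 T → deriv h t ≤ 0 := by
    filter_upwards [hWd, hβd] with t h1 h2 htT
    have htT' := htT
    rw [uIcc_of_le hT] at htT'
    have hd := ((h2 htT).neg.exp).mul (HasDerivAt.fun_sum fun i (_ : i ∈ Finset.univ) =>
      HasDerivAt.fun_sum fun j (_ : j ∈ Finset.univ) =>
        ((h1 htT i).mul (h1 htT j)).mul (hφd i j t))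
    have hwt : ∀ i, W i t = w t i := fun i => (hw t htT' i).symm
    have hd' := hd.deriv
    change deriv h t = _ at hd'
    rw [hd']
    have hF : (flow L (T - t) K).PosSemidef := posSemidef_flow _ _ γ hK (by linarith [htT'.2])
    have key := quadratic_form_deriv_le A N hγ hF (c t) (w t)
    rw [← hfw t htT', hquad, hquad, hquad, hquad] at key
    simp only [Pi.mul_apply, Pi.neg_apply, hwt]
    have hsum : ∑ i, ∑ j, ((f t i * w t j + w t i * f t j) * φ i j t +
          w t i * w t j * -(L (flow L (T - t) K) i j)) =
        ∑ i, ∑ j, f t i * w t j * flow L (T - t) K i j +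
          ∑ i, ∑ j, w t i * f t j * flow L (T - t) K i j -
          ∑ i, ∑ j, w t i * w t j * lyapOp Aᵀ (fun k => (N k)ᵀ) γ (flow L (T - t) K) i j := by
      simp only [← Finset.sum_add_distrib, ← Finset.sum_sub_distrib]
      refine Finset.sum_congr rfl fun i _ => Finset.sum_congr rfl fun j _ => ?_
      change _ + w t i * w t j * -(lyapOp Aᵀ (fun k => (N k)ᵀ) γ (flow L (T - t) K) i j) = _
      simp only [hφ]
      ring
    rw [hsum]
    have hb' : b t = γ ^ 2 * ∑ k, c t k ^ 2 := rfl
    rw [← hb'] at key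
    change _ ≤ b t * ∑ i, ∑ j, w t i * w t j * φ i j t at key
    have he := Real.exp_pos (-β t)
    have hmul := mul_le_mul_of_nonneg_left key he.le
    generalize (∑ i, ∑ j, w t i * w t j * φ i j t) = s₀ at hmul ⊢
    linarith
  have hfin := le_of_absolutelyContinuousOnInterval hT hhac hhd
  have hW0 : ∀ i, W i 0 = w 0 i := fun i => (hw 0 ⟨le_rfl, hT⟩ i).symm
  have hWT : ∀ i, W i T = w T i := fun i => (hw T ⟨hT, le_rfl⟩ i).symm
  have hβ00 : β 0 = 0 := intervalIntegral.integral_same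
  simp only [hh, hW0, hWT, hφ, hβ00, sub_self, sub_zero, flow_zero, neg_zero, Real.exp_zero,
    one_mul] at hfin
  rw [hquad, hquad]
  rw [Real.exp_neg, inv_mul_le_iff₀ (Real.exp_pos _)] at hfin
  exact hfin

/-- Evaluating the form at `v j eᵢ - v i eⱼ` and summing over all pairs gives the bound. -/
theorem dotProduct_mulVec_le_trace {G : Matrix ι ι ℝ} (hG : G.PosSemidef) (v : ι → ℝ) :
    v ⬝ᵥ G *ᵥ v ≤ (∑ i, v i ^ 2) * G.trace := by
  have h : ∀ i j, v i * (G i j * v j) ≤ (v j ^ 2 * G i i + v i ^ 2 * G j j) / 2 := by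
    intro i j
    have hs : G j i = G i j := by simpa using hG.isHermitian.apply i j
    have := hG.dotProduct_mulVec_nonneg (v j • Pi.single i 1 - v i • Pi.single j 1)
    simp [Matrix.mulVec_sub, Matrix.mulVec_smul, sub_dotProduct, dotProduct_sub, hs] at this
    linarith
  have h1 : v ⬝ᵥ G *ᵥ v ≤ ∑ i, ∑ j, (v j ^ 2 * G i i + v i ^ 2 * G j j) / 2 := by
    simp only [dotProduct, Matrix.mulVec, Finset.mul_sum]
    exact Finset.sum_le_sum fun i _ => Finset.sum_le_sum fun j _ => h i j
  refine h1.trans (le_of_eq ?_)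
  simp only [← Finset.sum_div, Finset.sum_add_distrib, ← Finset.mul_sum, ← Finset.sum_mul,
    Matrix.trace, Matrix.diag_apply]
  ring

theorem IsL2.intervalIntegrable_norm_sq {d : ℕ} {u : ℝ → EuclideanSpace ℝ (Fin d)} (hu : IsL2 u)
    {T : ℝ} (hT : 0 ≤ T) : IntervalIntegrable (fun t => ‖u t‖ ^ 2) volume 0 T := by
  rw [intervalIntegrable_iff_integrableOn_Ioc_of_le hT]
  have h : IntegrableOn (fun t => ‖u t‖ ^ 2) (Ioi 0) := hu.integrable_norm_pow two_ne_zero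
  exact h.mono_set Ioc_subset_Ioi_self

theorem IsL2.intervalIntegrable_apply {d : ℕ} {u : ℝ → EuclideanSpace ℝ (Fin d)} (hu : IsL2 u)
    {T : ℝ} (hT : 0 ≤ T) (k : Fin d) : IntervalIntegrable (fun t => u t k) volume 0 T := by
  rw [intervalIntegrable_iff_integrableOn_Ioc_of_le hT]
  have h : MemLp u 2 (volume.restrict (Ioc 0 T)) :=
    hu.mono_measure (Measure.restrict_mono Ioc_subset_Ioi_self le_rfl)
  have h1 := h.integrable (by norm_num)
  exact (EuclideanSpace.proj (𝕜 := ℝ) k).integrable_comp h1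

theorem HomSystem.IsState.intervalIntegrable {sys : HomSystem m p q ι}
    {u : ℝ → EuclideanSpace ℝ (Fin m)} {v₀ : EuclideanSpace ℝ (Fin q)}
    {x : ℝ → EuclideanSpace ℝ ι} (hu : IsL2 u) (hx : sys.IsState u v₀ x) {T : ℝ} (hT : 0 ≤ T) :
    IntervalIntegrable (fun τ => Matrix.toEuclideanLin sys.A (x τ) +
        ∑ k, u τ k • Matrix.toEuclideanLin (sys.N k) (x τ)) volume 0 T := by
  have hcont : ∀ B : Matrix ι ι ℝ,
      ContinuousOn (fun t => Matrix.toEuclideanLin B (x t)) (uIcc 0 T) := by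
    intro B
    rw [uIcc_of_le hT]
    exact (LinearMap.continuous_of_finiteDimensional (Matrix.toEuclideanLin B)).comp_continuousOn
      (hx.1.mono Icc_subset_Ici_self)
  have h := IntervalIntegrable.sum Finset.univ fun k _ =>
    (hu.intervalIntegrable_apply hT k).smul_continuousOn (hcont (sys.N k))
  refine (hcont sys.A).intervalIntegrable.add (h.congr fun t _ => ?_)
  rw [Finset.sum_apply]

/-- The output is bounded by the flow of the Lyapunov operator. -/
theorem HomSystem.IsState.norm_sq_output_le {sys : HomSystem m p q ι}
    {u : ℝ → EuclideanSpace ℝ (Fin m)} {v₀ : EuclideanSpace ℝ (Fin q)}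
    {x : ℝ → EuclideanSpace ℝ ι} {γ : ℝ} (hγ : 0 < γ) (hu : IsL2 u) (hx : sys.IsState u v₀ x)
    {T : ℝ} (hT : 0 ≤ T) :
    ‖Matrix.toEuclideanLin sys.C (x T)‖ ^ 2 ≤
      Real.exp (∫ t in (0:ℝ)..T, γ ^ 2 * ‖u t‖ ^ 2) * (‖v₀‖ ^ 2 *
        (sys.C * flow (lyapCLM sys.A sys.N γ) T (sys.X₀ * sys.X₀ᵀ) * sys.Cᵀ).trace) := by
  set w : ℝ → ι → ℝ := fun t => WithLp.ofLp (x t) with hw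
  set f : ℝ → ι → ℝ := fun t => sys.A *ᵥ w t + ∑ k, u t k • sys.N k *ᵥ w t with hf
  set F := fun τ => Matrix.toEuclideanLin sys.A (x τ) +
        ∑ k, u τ k • Matrix.toEuclideanLin (sys.N k) (x τ) with hF
  have hFf : ∀ t, WithLp.ofLp (F t) = f t := by
    intro t
    simp [hF, hf, hw]
  have hFi : IntervalIntegrable F volume 0 T := hx.intervalIntegrable hu hT
  let π : ι → EuclideanSpace ℝ ι →L[ℝ] ℝ := fun i => EuclideanSpace.proj i
  have hfi : ∀ i, IntervalIntegrable (fun t => f t i) volume 0 T := by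
    intro i
    have : IntervalIntegrable (fun t => π i (F t)) volume 0 T :=
      ⟨(π i).integrable_comp hFi.1, (π i).integrable_comp hFi.2⟩
    exact this.congr (fun t _ => congrFun (hFf t) i)
  have hnorm : ∀ t, ∑ k, u t k ^ 2 = ‖u t‖ ^ 2 := fun t => (EuclideanSpace.real_norm_sq_eq _).symm
  have hx0 : x 0 = Matrix.toEuclideanLin sys.X₀ v₀ := by
    simpa using hx.2 0 le_rfl
  have hmain := quadratic_form_state_le sys.A sys.N hγ (posSemidef_transpose_mul sys.C) hT
    (c := fun t k => u t k) (w := w) (f := f)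
    (by simp_rw [hnorm]; exact (hu.intervalIntegrable_norm_sq hT).const_mul _) hfi
    (fun t _ => rfl) (fun t ht i => by
      have h1 := hx.2 t ht.1
      have h2 := (π i).intervalIntegral_comp_comm
        (hFi.mono_set (by rw [uIcc_of_le hT, uIcc_of_le ht.1]; exact Icc_subset_Icc_right ht.2) :
          IntervalIntegrable F volume 0 t)
      have h3 : ∫ τ in (0:ℝ)..t, f τ i = (∫ τ in (0:ℝ)..t, F τ) i := by
        refine Eq.trans ?_ h2
        exact intervalIntegral.integral_congr fun τ _ => (congrFun (hFf τ) i).symm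
      rw [h3, hw]
      simp only [h1, hx0]
      rfl)
  simp_rw [hnorm] at hmain
  have h1 : w T ⬝ᵥ (sys.Cᵀ * sys.C) *ᵥ w T = ‖Matrix.toEuclideanLin sys.C (x T)‖ ^ 2 := by
    rw [← Matrix.mulVec_mulVec, Matrix.dotProduct_mulVec, Matrix.vecMul_transpose,
      EuclideanSpace.real_norm_sq_eq]
    simp [dotProduct, pow_two, hw]
  rw [h1] at hmain
  refine hmain.trans (mul_le_mul_of_nonneg_left ?_ (Real.exp_nonneg _))
  set Φ := flow (lyapCLM sys.Aᵀ (fun k => (sys.N k)ᵀ) γ) T (sys.Cᵀ * sys.C)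
  have hΦ : Φ.PosSemidef := posSemidef_flow _ _ γ (posSemidef_transpose_mul sys.C) hT
  -- Trace duality exchanges the adjoint flow started at `Cᵀ C` for the primal flow started at `X₀
  -- X₀ᵀ`.
  have h2 : (sys.C * flow (lyapCLM sys.A sys.N γ) T (sys.X₀ * sys.X₀ᵀ) * sys.Cᵀ).trace =
      (sys.X₀ᵀ * Φ * sys.X₀).trace := by
    rw [Matrix.trace_mul_comm, ← Matrix.mul_assoc, ← trace_flow_mul, ← Matrix.mul_assoc,
      Matrix.trace_mul_comm, Matrix.mul_assoc]
  rw [h2]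
  have h3 : w 0 ⬝ᵥ Φ *ᵥ w 0 = WithLp.ofLp v₀ ⬝ᵥ (sys.X₀ᵀ * Φ * sys.X₀) *ᵥ WithLp.ofLp v₀ := by
    have h4 : w 0 = sys.X₀ *ᵥ WithLp.ofLp v₀ := by rw [hw]; simp [hx0]
    rw [h4, ← Matrix.mulVec_mulVec, ← Matrix.mulVec_mulVec, Matrix.dotProduct_mulVec _ sys.X₀ᵀ,
      Matrix.vecMul_transpose]
  rw [h3, EuclideanSpace.real_norm_sq_eq]
  exact dotProduct_mulVec_le_trace (posSemidef_transpose_mul_mul hΦ sys.X₀) _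

end control

/-! ### Compression of the adjoint Lyapunov equation and the trace formula -/

section reduction

variable {m p q r s : ℕ}

/-- The embedding of the reduced coordinates which yields the reduced coefficients. -/
def HomSystem.embedding (bal : HomSystem m p q (Fin r ⊕ Fin s)) (μ : Method) :
    Matrix (Fin r ⊕ Fin s) (Fin r) ℝ := Matrix.fromRows 1 (bal.boldABar μ)

theorem mul_fromRows_one (A : Matrix (Fin r ⊕ Fin s) (Fin r ⊕ Fin s) ℝ)
    (B : Matrix (Fin s) (Fin r) ℝ) :
    A * Matrix.fromRows (1 : Matrix (Fin r) (Fin r) ℝ) B =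
      Matrix.fromRows (A.toBlocks₁₁ + A.toBlocks₁₂ * B) (A.toBlocks₂₁ + A.toBlocks₂₂ * B) := by
  conv_lhs => rw [← A.fromBlocks_toBlocks]
  rw [Matrix.fromBlocks_mul_fromRows, Matrix.mul_one, Matrix.mul_one]

variable (bal : HomSystem m p q (Fin r ⊕ Fin s)) (μ : Method)

/-- For SPA the lower block is `A₂₁ - A₂₂ A₂₂⁻¹ A₂₁ = 0`, the only place where invertibility of
`A₂₂` enters the compression. This identity lets both methods share one computation. -/
theorem HomSystem.A_mul_embedding (hspa : μ = Method.spa → IsUnit bal.A.toBlocks₂₂) :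
    bal.A * bal.embedding μ = Matrix.fromRows (bal.reduced μ).A (bal.boldA μ) := by
  rw [HomSystem.embedding, mul_fromRows_one]
  cases μ with
  | bt => simp [HomSystem.boldABar, HomSystem.reduced, HomSystem.boldA]
  | spa =>
    have h := (Matrix.isUnit_iff_isUnit_det _).1 (hspa rfl)
    simp [HomSystem.boldABar, HomSystem.reduced, HomSystem.boldA, ← Matrix.mul_assoc,
      Matrix.mul_nonsing_inv _ h, sub_eq_add_neg]

theorem HomSystem.N_mul_embedding (k : Fin m) :
    bal.N k * bal.embedding μ = Matrix.fromRows ((bal.reduced μ).N k) (bal.boldN k μ) := by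
  rw [HomSystem.embedding, mul_fromRows_one]
  cases μ <;> simp [HomSystem.boldABar, HomSystem.reduced, HomSystem.boldN, ← Matrix.mul_assoc,
      sub_eq_add_neg]

theorem HomSystem.C_mul_embedding : bal.C * bal.embedding μ = (bal.reduced μ).C := by
  rw [HomSystem.embedding]
  conv_lhs => rw [← Matrix.fromCols_toCols bal.C]
  rw [Matrix.fromCols_mul_fromRows, Matrix.mul_one]
  cases μ <;> simp [HomSystem.boldABar, HomSystem.reduced, ← Matrix.mul_assoc, sub_eq_add_neg]

theorem HomSystem.reduced_X₀ : (bal.reduced μ).X₀ = bal.X₀.toRows₁ := by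
  cases μ <;> rfl

/-- Each method makes one of the two factors zero; thus the drift contributes no `Θ₂` term to the
compressed equation. -/
theorem HomSystem.boldA_transpose_mul_mul_boldABar (D : Matrix (Fin s) (Fin s) ℝ) :
    (bal.boldA μ)ᵀ * D * bal.boldABar μ = 0 ∧ (bal.boldABar μ)ᵀ * D * bal.boldA μ = 0 := by
  cases μ <;> simp [HomSystem.boldA, HomSystem.boldABar]

theorem fromRows_transpose_mul_diagonal_mul {c d : Type} (θ₁ : Fin r → ℝ) (θ₂ : Fin s → ℝ)
    (a : Matrix (Fin r) c ℝ) (b : Matrix (Fin s) c ℝ) (a' : Matrix (Fin r) d ℝ)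
    (b' : Matrix (Fin s) d ℝ) :
    (Matrix.fromRows a b)ᵀ * Matrix.diagonal (Sum.elim θ₁ θ₂) * Matrix.fromRows a' b' =
      aᵀ * Matrix.diagonal θ₁ * a' + bᵀ * Matrix.diagonal θ₂ * b' := by
  rw [← Matrix.fromBlocks_diagonal, Matrix.transpose_fromRows, Matrix.fromCols_mul_fromBlocks,
    Matrix.fromCols_mul_fromRows]
  simp

variable {bal} {γ : ℝ} {θ₁ : Fin r → ℝ} {θ₂ : Fin s → ℝ}

/-- The adjoint Lyapunov equation of the balanced system, compressed to the reduced coordinates. -/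
theorem HomSystem.reduced_adjoint_lyapOp {μ : Method}
    (hspa : μ = Method.spa → IsUnit bal.A.toBlocks₂₂)
    (hQ : lyapOp bal.Aᵀ (fun k => (bal.N k)ᵀ) γ (Matrix.diagonal (Sum.elim θ₁ θ₂)) =
      -(bal.Cᵀ * bal.C)) :
    lyapOp (bal.reduced μ).Aᵀ (fun k => ((bal.reduced μ).N k)ᵀ) γ (Matrix.diagonal θ₁) =
      -((bal.reduced μ).Cᵀ * (bal.reduced μ).C) -
        (1 / γ ^ 2) • ∑ k, (bal.boldN k μ)ᵀ * Matrix.diagonal θ₂ * bal.boldN k μ := by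
  have h := congrArg (fun X => (bal.embedding μ)ᵀ * X * bal.embedding μ) hQ
  set V := bal.embedding μ with hV
  have hA := bal.A_mul_embedding μ hspa
  have e1 : Vᵀ * (bal.Aᵀ * Matrix.diagonal (Sum.elim θ₁ θ₂)) * V =
      ((bal.reduced μ).A)ᵀ * Matrix.diagonal θ₁ := by
    rw [← Matrix.mul_assoc, ← Matrix.transpose_mul, hA, hV, HomSystem.embedding,
      fromRows_transpose_mul_diagonal_mul, (bal.boldA_transpose_mul_mul_boldABar μ _).1,
      Matrix.mul_one, add_zero]
  have e2 : Vᵀ * (Matrix.diagonal (Sum.elim θ₁ θ₂) * bal.A) * V =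
      Matrix.diagonal θ₁ * (bal.reduced μ).A := by
    rw [← Matrix.mul_assoc, Matrix.mul_assoc, hA, hV, HomSystem.embedding,
      fromRows_transpose_mul_diagonal_mul, (bal.boldA_transpose_mul_mul_boldABar μ _).2,
      Matrix.transpose_one, Matrix.one_mul, add_zero]
  have e3 : ∀ k, Vᵀ * ((bal.N k)ᵀ * Matrix.diagonal (Sum.elim θ₁ θ₂) * bal.N k) * V =
      ((bal.reduced μ).N k)ᵀ * Matrix.diagonal θ₁ * (bal.reduced μ).N k +
        (bal.boldN k μ)ᵀ * Matrix.diagonal θ₂ * bal.boldN k μ := by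
    intro k
    rw [← fromRows_transpose_mul_diagonal_mul, ← bal.N_mul_embedding, ← hV, Matrix.transpose_mul]
    simp only [Matrix.mul_assoc]
  have e4 : Vᵀ * (bal.Cᵀ * bal.C) * V = (bal.reduced μ).Cᵀ * (bal.reduced μ).C := by
    rw [← bal.C_mul_embedding, ← hV, Matrix.transpose_mul]
    simp only [Matrix.mul_assoc]
  simp only [lyapOp, sylvOp, Matrix.mul_add, Matrix.add_mul, Matrix.mul_smul, Matrix.smul_mul,
    Matrix.mul_sum, Matrix.sum_mul, Matrix.transpose_transpose, Matrix.mul_neg, Matrix.neg_mul,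
    e1, e2, e3, e4, Finset.sum_add_distrib, smul_add] at h ⊢
  rw [← h]
  abel

/-- The compressed cross term of the adjoint Lyapunov equation. -/
theorem HomSystem.trace_mixed {μ : Method} (hspa : μ = Method.spa → IsUnit bal.A.toBlocks₂₂)
    (hQ : lyapOp bal.Aᵀ (fun k => (bal.N k)ᵀ) γ (Matrix.diagonal (Sum.elim θ₁ θ₂)) =
      -(bal.Cᵀ * bal.C)) {Y : Matrix (Fin r ⊕ Fin s) (Fin r) ℝ} (hY : bal.IsMixedSol μ γ Y) :
    (bal.C * Y * (bal.reduced μ).Cᵀ).trace =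
      (Matrix.diagonal θ₁ * (bal.X₀.toRows₁ * bal.X₀.toRows₁ᵀ)).trace -
      (Matrix.diagonal θ₂ * (Y.toRows₂ * (bal.boldA μ)ᵀ + bal.A.toRows₂ * Y * (bal.boldABar μ)ᵀ +
        (1 / γ ^ 2) • ∑ k, (bal.N k).toRows₂ * Y * (bal.boldN k μ)ᵀ)).trace := by
  -- Testing with `V` on the left and `Y` on the right makes the `Θ₁` terms assemble into the first
  -- block row of the mixed equation, which `hY1` evaluates.
  have h := congrArg (fun X => ((bal.embedding μ)ᵀ * X * Y).trace) hQ
  set V := bal.embedding μ with hV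
  have hA := bal.A_mul_embedding μ hspa
  have hrows : ∀ B : Matrix (Fin r ⊕ Fin s) (Fin r ⊕ Fin s) ℝ,
      B * Y = Matrix.fromRows (B.toRows₁ * Y) (B.toRows₂ * Y) := by
    intro B
    conv_lhs => rw [← Matrix.fromRows_toRows B]
    rw [Matrix.fromRows_mul]
  have hcyc : ∀ {d : ℕ} (D : Matrix (Fin d) (Fin d) ℝ) (X : Matrix (Fin d) (Fin r) ℝ)
      (B : Matrix (Fin d) (Fin r) ℝ), (Bᵀ * D * X).trace = (D * (X * Bᵀ)).trace := by
    intro d D X B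
    rw [Matrix.mul_assoc, Matrix.trace_mul_comm, Matrix.mul_assoc]
  have e1 : (Vᵀ * (bal.Aᵀ * Matrix.diagonal (Sum.elim θ₁ θ₂)) * Y).trace =
      (Matrix.diagonal θ₁ * (Y.toRows₁ * ((bal.reduced μ).A)ᵀ)).trace +
        (Matrix.diagonal θ₂ * (Y.toRows₂ * (bal.boldA μ)ᵀ)).trace := by
    rw [← hcyc, ← hcyc, ← Matrix.trace_add, ← fromRows_transpose_mul_diagonal_mul,
      Matrix.fromRows_toRows, ← hA, Matrix.transpose_mul, ← Matrix.mul_assoc]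
  have e2 : (Vᵀ * (Matrix.diagonal (Sum.elim θ₁ θ₂) * bal.A) * Y).trace =
      (Matrix.diagonal θ₁ * (bal.A.toRows₁ * Y)).trace +
        (Matrix.diagonal θ₂ * (bal.A.toRows₂ * Y * (bal.boldABar μ)ᵀ)).trace := by
    rw [← Matrix.mul_assoc, Matrix.mul_assoc, hrows, hV, HomSystem.embedding,
      fromRows_transpose_mul_diagonal_mul, Matrix.transpose_one, Matrix.one_mul, Matrix.trace_add,
      hcyc]
  have e3 : ∀ k, (Vᵀ * ((bal.N k)ᵀ * Matrix.diagonal (Sum.elim θ₁ θ₂) * bal.N k) * Y).trace =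
      (Matrix.diagonal θ₁ * ((bal.N k).toRows₁ * Y * ((bal.reduced μ).N k)ᵀ)).trace +
        (Matrix.diagonal θ₂ * ((bal.N k).toRows₂ * Y * (bal.boldN k μ)ᵀ)).trace := by
    intro k
    rw [← hcyc, ← hcyc, ← Matrix.trace_add, ← fromRows_transpose_mul_diagonal_mul, ← hrows,
      ← bal.N_mul_embedding, ← hV, Matrix.transpose_mul]
    simp only [Matrix.mul_assoc]
  have e4 : (Vᵀ * (bal.Cᵀ * bal.C) * Y).trace = (bal.C * Y * (bal.reduced μ).Cᵀ).trace := by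
    rw [← bal.C_mul_embedding, ← hV, Matrix.trace_mul_comm (bal.C * Y), Matrix.transpose_mul]
    simp only [Matrix.mul_assoc]
  have hY1 : bal.A.toRows₁ * Y + Y.toRows₁ * (bal.reduced μ).Aᵀ +
      (1 / γ ^ 2) • ∑ k, (bal.N k).toRows₁ * Y * ((bal.reduced μ).N k)ᵀ =
        -(bal.X₀.toRows₁ * bal.X₀.toRows₁ᵀ) := by
    have h1 := congrArg Matrix.toRows₁ hY
    ext i j
    have h2 := congrFun₂ h1 i j
    simpa [sylvOp, Matrix.toRows₁, Matrix.mul_apply, Matrix.sum_apply] using h2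
  have hY2 := congrArg (fun X => (Matrix.diagonal θ₁ * X).trace) hY1
  simp only [lyapOp, sylvOp, Matrix.mul_add, Matrix.add_mul, Matrix.mul_smul, Matrix.smul_mul,
    Matrix.mul_sum, Matrix.sum_mul, Matrix.transpose_transpose, Matrix.mul_neg, Matrix.neg_mul,
    Matrix.trace_add, Matrix.trace_smul, Matrix.trace_sum, Matrix.trace_neg,
    e1, e2, e3, e4, Finset.sum_add_distrib, smul_add] at h hY2 ⊢
  linarith

/-- Each of the three traces contains `tr (Θ₁ X₀,₁ X₀,₁ᵀ)` once, and `1 - 2 + 1 = 0`. -/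
theorem HomSystem.trace_error_eq {μ : Method} (hspa : μ = Method.spa → IsUnit bal.A.toBlocks₂₂)
    (hP : lyapOp bal.A bal.N γ (Matrix.diagonal (Sum.elim θ₁ θ₂)) = -(bal.X₀ * bal.X₀ᵀ))
    (hQ : lyapOp bal.Aᵀ (fun k => (bal.N k)ᵀ) γ (Matrix.diagonal (Sum.elim θ₁ θ₂)) =
      -(bal.Cᵀ * bal.C)) {Pr : Matrix (Fin r) (Fin r) ℝ}
    (hPr : lyapOp (bal.reduced μ).A (bal.reduced μ).N γ Pr =
      -((bal.reduced μ).X₀ * (bal.reduced μ).X₀ᵀ))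
    {Y : Matrix (Fin r ⊕ Fin s) (Fin r) ℝ} (hY : bal.IsMixedSol μ γ Y) :
    (bal.C * Matrix.diagonal (Sum.elim θ₁ θ₂) * bal.Cᵀ).trace -
        2 * (bal.C * Y * (bal.reduced μ).Cᵀ).trace +
        ((bal.reduced μ).C * Pr * (bal.reduced μ).Cᵀ).trace =
      (Matrix.diagonal θ₂ * bal.weight μ γ Pr Y).trace := by
  have h1 : (bal.C * Matrix.diagonal (Sum.elim θ₁ θ₂) * bal.Cᵀ).trace =
      (Matrix.diagonal θ₁ * (bal.X₀.toRows₁ * bal.X₀.toRows₁ᵀ)).trace +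
        (Matrix.diagonal θ₂ * (bal.X₀.toRows₂ * bal.X₀.toRows₂ᵀ)).trace := by
    -- Both Gramians equal `Θ`, so pairing `Θ` with itself gives `tr (C Θ Cᵀ) = tr (X₀ᵀ Θ X₀)`.
    have h := trace_lyapOp_mul bal.A bal.N γ (Matrix.diagonal (Sum.elim θ₁ θ₂))
      (Matrix.diagonal (Sum.elim θ₁ θ₂))
    rw [hP, hQ, Matrix.neg_mul, Matrix.mul_neg, Matrix.trace_neg, Matrix.trace_neg, neg_inj] at h
    rw [Matrix.trace_mul_comm, ← Matrix.mul_assoc, h, ← Matrix.mul_assoc, Matrix.trace_mul_comm,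
      ← Matrix.mul_assoc]
    conv_lhs => rw [← Matrix.fromRows_toRows bal.X₀]
    rw [fromRows_transpose_mul_diagonal_mul, Matrix.trace_add, Matrix.mul_assoc,
      Matrix.trace_mul_comm, Matrix.mul_assoc (bal.X₀.toRows₂ᵀ),
      Matrix.trace_mul_comm (bal.X₀.toRows₂ᵀ)]
    simp only [Matrix.mul_assoc]
  have h2 : ((bal.reduced μ).C * Pr * (bal.reduced μ).Cᵀ).trace =
      (Matrix.diagonal θ₁ * (bal.X₀.toRows₁ * bal.X₀.toRows₁ᵀ)).trace -
        1 / γ ^ 2 * ∑ k, (Matrix.diagonal θ₂ * (bal.boldN k μ * Pr * (bal.boldN k μ)ᵀ)).trace := by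
    have h := trace_lyapOp_mul (bal.reduced μ).A (bal.reduced μ).N γ (Matrix.diagonal θ₁) Pr
    rw [HomSystem.reduced_adjoint_lyapOp hspa hQ, hPr, bal.reduced_X₀] at h
    have hk : ∀ k, ((bal.boldN k μ)ᵀ * Matrix.diagonal θ₂ * bal.boldN k μ * Pr).trace =
        (Matrix.diagonal θ₂ * (bal.boldN k μ * Pr * (bal.boldN k μ)ᵀ)).trace := fun k => by
      rw [Matrix.mul_assoc, Matrix.mul_assoc, Matrix.trace_mul_comm, Matrix.mul_assoc]
    simp only [Matrix.sub_mul, Matrix.neg_mul, Matrix.mul_neg, Matrix.smul_mul, Matrix.sum_mul,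
      Matrix.trace_sub, Matrix.trace_neg, Matrix.trace_smul, Matrix.trace_sum, smul_eq_mul, hk] at h
    rw [Matrix.trace_mul_comm, ← Matrix.mul_assoc]
    linarith
  rw [h1, h2, HomSystem.trace_mixed hspa hQ hY]
  simp only [HomSystem.weight, Matrix.mul_add, Matrix.mul_sub, Matrix.mul_smul, Matrix.mul_sum,
    Matrix.trace_add, Matrix.trace_sub, Matrix.trace_smul, Matrix.trace_sum, smul_eq_mul,
    Finset.sum_sub_distrib]
  simp only [← Finset.mul_sum]
  ring

end reduction

/-! ### Coordinate changes, error output and the `L²` bound -/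

section assembly

variable {m p q : ℕ} {ι κ : Type} [Fintype ι] [DecidableEq ι] [Fintype κ] [DecidableEq κ]

theorem HomSystem.IsGramianP.transform {sys : HomSystem m p q ι} {γ : ℝ} {P : Matrix ι ι ℝ}
    (h : sys.IsGramianP γ P) {S : Matrix κ ι ℝ} {T : Matrix ι κ ℝ} (hTS : T * S = 1) :
    (sys.transform S T).IsGramianP γ (S * P * Sᵀ) := by
  have := IsGramian.congr_transform h S T hTS
  simpa [HomSystem.IsGramianP, HomSystem.transform, Matrix.transpose_mul,
    Matrix.mul_assoc] using this

theorem HomSystem.IsGramianQ.transform {sys : HomSystem m p q ι} {γ : ℝ} {Q : Matrix ι ι ℝ}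
    (h : sys.IsGramianQ γ Q) {S : Matrix κ ι ℝ} {T : Matrix ι κ ℝ} (hTS : T * S = 1) :
    (sys.transform S T).IsGramianQ γ (Tᵀ * Q * T) := by
  have hST : Sᵀ * Tᵀ = 1 := by rw [← Matrix.transpose_mul, hTS, Matrix.transpose_one]
  have := IsGramian.congr_transform h Tᵀ Sᵀ hST
  simpa [HomSystem.IsGramianQ, HomSystem.transform, Matrix.transpose_mul,
    Matrix.mul_assoc] using this

theorem toEuclideanLin_mul_apply {α β δ : Type} [Fintype α] [DecidableEq α] [Fintype β]
    [DecidableEq β] [Fintype δ] [DecidableEq δ] (A : Matrix α β ℝ) (B : Matrix β δ ℝ)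
    (v : EuclideanSpace ℝ δ) :
    Matrix.toEuclideanLin (A * B) v = Matrix.toEuclideanLin A (Matrix.toEuclideanLin B v) := by
  ext i
  simp [Matrix.mulVec_mulVec]

/-- A matrix intertwines the right-hand sides of two systems if it intertwines the coefficients. -/
theorem toEuclideanLin_rhs {A : Matrix ι ι ℝ} {N : Fin m → Matrix ι ι ℝ} {A' : Matrix κ κ ℝ}
    {N' : Fin m → Matrix κ κ ℝ} {J : Matrix κ ι ℝ} (hA : J * A = A' * J)
    (hN : ∀ k, J * N k = N' k * J) (c : Fin m → ℝ) (v : EuclideanSpace ℝ ι) :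
    Matrix.toEuclideanLin J (Matrix.toEuclideanLin A v + ∑ k, c k • Matrix.toEuclideanLin (N k) v) =
      Matrix.toEuclideanLin A' (Matrix.toEuclideanLin J v) +
        ∑ k, c k • Matrix.toEuclideanLin (N' k) (Matrix.toEuclideanLin J v) := by
  simp only [map_add, map_sum, map_smul, ← toEuclideanLin_mul_apply, hA, hN]

theorem intervalIntegral_toEuclideanLin (J : Matrix κ ι ℝ) {f : ℝ → EuclideanSpace ℝ ι} {t : ℝ}
    (hf : IntervalIntegrable f volume 0 t) :
    Matrix.toEuclideanLin J (∫ τ in (0:ℝ)..t, f τ) =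
      ∫ τ in (0:ℝ)..t, Matrix.toEuclideanLin J (f τ) :=
  ((LinearMap.toContinuousLinearMap (Matrix.toEuclideanLin J)).intervalIntegral_comp_comm hf).symm

theorem HomSystem.IsOutput.transform {sys : HomSystem m p q ι}
    {u : ℝ → EuclideanSpace ℝ (Fin m)} {v₀ : EuclideanSpace ℝ (Fin q)}
    {y : ℝ → EuclideanSpace ℝ (Fin p)} (hu : IsL2 u) (hy : sys.IsOutput u v₀ y)
    {S : Matrix κ ι ℝ} {T : Matrix ι κ ℝ} (hTS : T * S = 1) :
    (sys.transform S T).IsOutput u v₀ y := by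
  obtain ⟨x, hx, hxy⟩ := hy
  have hS : ∀ {α : Type} [Fintype α] (B : Matrix α ι ℝ), B * T * S = B := fun B => by
    rw [Matrix.mul_assoc, hTS, Matrix.mul_one]
  refine ⟨fun t => Matrix.toEuclideanLin S (x t), ⟨?_, fun t ht => ?_⟩, fun t ht => ?_⟩
  · exact (LinearMap.continuous_of_finiteDimensional
      (Matrix.toEuclideanLin S)).comp_continuousOn hx.1
  · beta_reduce
    rw [hx.2 t ht, map_add, intervalIntegral_toEuclideanLin S (hx.intervalIntegrable hu ht),
      ← toEuclideanLin_mul_apply]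
    congr 1
    exact intervalIntegral.integral_congr fun τ _ =>
      toEuclideanLin_rhs (hS (S * sys.A)).symm (fun k => (hS (S * sys.N k)).symm) _ _
  · rw [hxy t ht, ← toEuclideanLin_mul_apply]
    exact congrArg (fun B => Matrix.toEuclideanLin B (x t)) (hS sys.C).symm

theorem transpose_projLeft_mul (A : Matrix ι ι ℝ) (B : Matrix κ κ ℝ) :
    (projLeft ι κ)ᵀ * A = Matrix.fromBlocks A 0 0 B * (projLeft ι κ)ᵀ := by
  simp [projLeft, Matrix.transpose_fromCols, Matrix.fromBlocks_mul_fromRows, Matrix.fromRows_mul]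

theorem transpose_projRight_mul (A : Matrix ι ι ℝ) (B : Matrix κ κ ℝ) :
    (projRight ι κ)ᵀ * B = Matrix.fromBlocks A 0 0 B * (projRight ι κ)ᵀ := by
  simp [projRight, Matrix.transpose_fromCols, Matrix.fromBlocks_mul_fromRows, Matrix.fromRows_mul]

theorem HomSystem.IsOutput.sub {sys : HomSystem m p q ι} {red : HomSystem m p q κ}
    {u : ℝ → EuclideanSpace ℝ (Fin m)} {v₀ : EuclideanSpace ℝ (Fin q)}
    {y yr : ℝ → EuclideanSpace ℝ (Fin p)} (hu : IsL2 u)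
    (hy : sys.IsOutput u v₀ y) (hyr : red.IsOutput u v₀ yr) :
    (sys.errorSystem red).IsOutput u v₀ (fun t => y t - yr t) := by
  obtain ⟨x, hx, hxy⟩ := hy
  obtain ⟨xr, hxr, hxyr⟩ := hyr
  refine ⟨fun t => Matrix.toEuclideanLin (projLeft ι κ)ᵀ (x t) +
    Matrix.toEuclideanLin (projRight ι κ)ᵀ (xr t), ⟨?_, fun t ht => ?_⟩, fun t ht => ?_⟩
  · exact ((LinearMap.continuous_of_finiteDimensional _).comp_continuousOn hx.1).add
      ((LinearMap.continuous_of_finiteDimensional _).comp_continuousOn hxr.1)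
  · have hi := hx.intervalIntegrable hu ht
    have hir := hxr.intervalIntegrable hu ht
    have hX : (projLeft ι κ)ᵀ * sys.X₀ + (projRight ι κ)ᵀ * red.X₀ = (sys.errorSystem red).X₀ := by
      ext (i | i) j <;> simp [projLeft, projRight, Matrix.transpose_fromCols, Matrix.fromRows_mul,
        HomSystem.errorSystem]
    have hsum : ∀ (f g : ℝ → EuclideanSpace ℝ (ι ⊕ κ)) (a b : EuclideanSpace ℝ (ι ⊕ κ)),
        IntervalIntegrable f volume 0 t → IntervalIntegrable g volume 0 t →
        (a + ∫ τ in (0:ℝ)..t, f τ) + (b + ∫ τ in (0:ℝ)..t, g τ) =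
          (a + b) + ∫ τ in (0:ℝ)..t, (f τ + g τ) := fun f g a b hf hg => by
      rw [intervalIntegral.integral_add hf hg]; abel
    have hcomp : ∀ {α : Type} [Fintype α] [DecidableEq α] (J : Matrix (ι ⊕ κ) α ℝ)
        {f : ℝ → EuclideanSpace ℝ α}, IntervalIntegrable f volume 0 t →
        IntervalIntegrable (fun τ => Matrix.toEuclideanLin J (f τ)) volume 0 t := fun J f hf =>
      ⟨(LinearMap.toContinuousLinearMap (Matrix.toEuclideanLin J)).integrable_comp hf.1,
        (LinearMap.toContinuousLinearMap (Matrix.toEuclideanLin J)).integrable_comp hf.2⟩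
    beta_reduce
    rw [hx.2 t ht, hxr.2 t ht, map_add, map_add, intervalIntegral_toEuclideanLin _ hi,
      intervalIntegral_toEuclideanLin _ hir, ← toEuclideanLin_mul_apply,
      ← toEuclideanLin_mul_apply, hsum _ _ _ _ (hcomp _ hi) (hcomp _ hir), ← hX, map_add]
    congr 1
    refine intervalIntegral.integral_congr fun τ _ => ?_
    simp only
    rw [toEuclideanLin_rhs (transpose_projLeft_mul sys.A red.A)
        (fun k => transpose_projLeft_mul (sys.N k) (red.N k)),
      toEuclideanLin_rhs (transpose_projRight_mul sys.A red.A)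
        (fun k => transpose_projRight_mul (sys.N k) (red.N k))]
    simp only [map_add, smul_add, Finset.sum_add_distrib, HomSystem.errorSystem]
    abel
  · have h1 : (sys.errorSystem red).C * (projLeft ι κ)ᵀ = sys.C := by
      simp [HomSystem.errorSystem, projLeft, Matrix.transpose_fromCols,
    Matrix.fromCols_mul_fromRows]
    have h2 : (sys.errorSystem red).C * (projRight ι κ)ᵀ = -red.C := by
      simp [HomSystem.errorSystem, projRight, Matrix.transpose_fromCols,
    Matrix.fromCols_mul_fromRows]
    beta_reduce
    rw [hxy t ht, hxyr t ht, map_add, ← toEuclideanLin_mul_apply, ← toEuclideanLin_mul_apply,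
      h1, h2, map_neg, LinearMap.neg_apply, sub_eq_add_neg]

/-- The output only depends on the control components which enter the system. -/
theorem HomSystem.IsOutput.congr_control {sys : HomSystem m p q ι}
    {u w : ℝ → EuclideanSpace ℝ (Fin m)} {v₀ : EuclideanSpace ℝ (Fin q)}
    {y : ℝ → EuclideanSpace ℝ (Fin p)} (hy : sys.IsOutput u v₀ y)
    (h : ∀ t k, w t k • sys.N k = u t k • sys.N k) : sys.IsOutput w v₀ y := by
  obtain ⟨x, hx, hxy⟩ := hy
  refine ⟨x, ⟨hx.1, fun t ht => ?_⟩, hxy⟩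
  rw [hx.2 t ht]
  congr 1
  refine intervalIntegral.integral_congr fun τ _ => ?_
  simp only
  congr 1
  refine Finset.sum_congr rfl fun k _ => ?_
  rw [← LinearMap.smul_apply, ← LinearMap.smul_apply, ← map_smul, ← map_smul, h]

theorem IsL2.effControl {u : ℝ → EuclideanSpace ℝ (Fin m)} (hu : IsL2 u) (sys : HomSystem m p q ι) :
    IsL2 (sys.effControl u) := by
  refine MemLp.of_eval_piLp fun k => ?_
  by_cases h : sys.N k = 0
  · simp [HomSystem.effControl, h]
  · simpa [HomSystem.effControl, h] using hu.eval_piLp k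

/-- The `L²` bound of the output in terms of the Gramian. -/
theorem HomSystem.IsOutput.l2Norm_le {sys : HomSystem m p q ι} {u : ℝ → EuclideanSpace ℝ (Fin m)}
    {v₀ : EuclideanSpace ℝ (Fin q)} {y : ℝ → EuclideanSpace ℝ (Fin p)} {γ : ℝ} (hγ : 0 < γ)
    (hu : IsL2 u) (hy : sys.IsOutput u v₀ y) {P : Matrix ι ι ℝ} (hP : sys.IsGramianP γ P) :
    IsL2 y ∧ l2Norm y ≤ Real.sqrt (sys.C * P * sys.Cᵀ).trace *
      Real.exp (1 / 2 * l2Norm (fun t => γ • u t) ^ 2) * ‖v₀‖ := by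
  obtain ⟨hi, rfl⟩ := isGramian_iff.1 hP
  obtain ⟨x, hx, hxy⟩ := hy
  set Z := fun t => flow (lyapCLM sys.A sys.N γ) t (sys.X₀ * sys.X₀ᵀ) with hZ
  set J : Matrix ι ι ℝ →L[ℝ] ℝ :=
    (LinearMap.toContinuousLinearMap (Matrix.traceLinearMap (Fin p) ℝ ℝ)).comp
      (mulMulCLM sys.C sys.Cᵀ) with hJ
  have hJi : IntegrableOn (fun t => J (Z t)) (Ioi 0) := J.integrable_comp hi
  have hJint : ∫ t in Ioi (0:ℝ), J (Z t) = (sys.C * (∫ t in Ioi (0:ℝ), Z t) * sys.Cᵀ).trace :=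
    J.integral_comp_comm hi
  set E := ∫ t in Ioi (0:ℝ), γ ^ 2 * ‖u t‖ ^ 2 with hE
  have hui : IntegrableOn (fun t => γ ^ 2 * ‖u t‖ ^ 2) (Ioi 0) :=
    (hu.integrable_norm_pow two_ne_zero).const_mul _
  have hEl : l2Norm (fun t => γ • u t) ^ 2 = E := by
    rw [l2Norm, Real.sq_sqrt (integral_nonneg fun t => by positivity), hE]
    refine integral_congr_ae (Eventually.of_forall fun t => ?_)
    simp only [norm_smul, mul_pow, Real.norm_eq_abs, sq_abs]
  have hJ0 : ∀ t ∈ Ioi (0:ℝ), 0 ≤ J (Z t) := fun t ht =>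
    (posSemidef_mul_mul_transpose (posSemidef_flow sys.A sys.N γ
      (posSemidef_mul_transpose sys.X₀) (le_of_lt ht)) sys.C).trace_nonneg
  have hbound : ∀ t ∈ Ioi (0:ℝ), ‖y t‖ ^ 2 ≤ (Real.exp E * ‖v₀‖ ^ 2) * J (Z t) := by
    intro t ht
    have ht' : 0 ≤ t := le_of_lt ht
    rw [hxy t ht', mul_assoc]
    refine (hx.norm_sq_output_le hγ hu ht').trans (mul_le_mul_of_nonneg_right ?_
      (mul_nonneg (by positivity) (hJ0 t ht)))
    -- The energy up to time `t` is replaced by the total energy, so the exponential factor is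
    -- constant under the integral.
    rw [Real.exp_le_exp, intervalIntegral.integral_of_le ht']
    exact setIntegral_mono_set hui (Eventually.of_forall fun t => by positivity)
      Ioc_subset_Ioi_self.eventuallyLE
  have hmeas : AEStronglyMeasurable y (volume.restrict (Ioi 0)) := by
    have h1 : ContinuousOn (fun t => Matrix.toEuclideanLin sys.C (x t)) (Ioi 0) :=
      (LinearMap.continuous_of_finiteDimensional _).comp_continuousOn
        (hx.1.mono Ioi_subset_Ici_self)
    refine (h1.congr fun t ht => hxy t (le_of_lt ht)).aestronglyMeasurable measurableSet_Ioi
  have hyi : IntegrableOn (fun t => ‖y t‖ ^ 2) (Ioi 0) := by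
    refine Integrable.mono' (hJi.const_mul (Real.exp E * ‖v₀‖ ^ 2)) (hmeas.norm.pow 2) ?_
    refine (ae_restrict_mem measurableSet_Ioi).mono fun t ht => ?_
    rw [Real.norm_of_nonneg (by positivity)]
    exact hbound t ht
  refine ⟨(memLp_two_iff_integrable_sq_norm hmeas).2 hyi, ?_⟩
  have hle : ∫ t in Ioi (0:ℝ), ‖y t‖ ^ 2 ≤
      (Real.exp E * ‖v₀‖ ^ 2) * (sys.C * (∫ t in Ioi (0:ℝ), Z t) * sys.Cᵀ).trace := by
    rw [← hJint, ← integral_const_mul]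
    exact setIntegral_mono_on hyi (hJi.const_mul _) measurableSet_Ioi hbound
  rw [l2Norm, hEl]
  refine Real.sqrt_le_iff.2 ⟨by positivity, hle.trans (le_of_eq ?_)⟩
  have h0 : 0 ≤ (sys.C * (∫ t in Ioi (0:ℝ), Z t) * sys.Cᵀ).trace := by
    rw [← hJint]; exact setIntegral_nonneg measurableSet_Ioi hJ0
  rw [mul_pow, mul_pow, Real.sq_sqrt h0, ← Real.exp_nat_mul]
  push_cast
  rw [show 2 * (1 / 2 * E) = E by ring]
  ring

theorem HomSystem.IsGramianP.trace_nonneg {sys : HomSystem m p q ι} {γ : ℝ} {P : Matrix ι ι ℝ}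
    (hP : sys.IsGramianP γ P) : 0 ≤ (sys.C * P * sys.Cᵀ).trace := by
  obtain ⟨hi, rfl⟩ := isGramian_iff.1 hP
  set J : Matrix ι ι ℝ →L[ℝ] ℝ :=
    (LinearMap.toContinuousLinearMap (Matrix.traceLinearMap (Fin p) ℝ ℝ)).comp
      (mulMulCLM sys.C sys.Cᵀ) with hJ
  change 0 ≤ J _
  rw [← J.integral_comp_comm hi]
  exact setIntegral_nonneg measurableSet_Ioi fun t ht =>
    (posSemidef_mul_mul_transpose (posSemidef_flow sys.A sys.N γ
      (posSemidef_mul_transpose sys.X₀) (le_of_lt ht)) sys.C).trace_nonneg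

theorem IsGramian.transpose_eq {A : Matrix ι ι ℝ} {N : Fin m → Matrix ι ι ℝ} {γ : ℝ}
    {K P : Matrix ι ι ℝ} (h : IsGramian A N γ K P) (hK : K.PosSemidef) : Pᵀ = P := by
  obtain ⟨hi, rfl⟩ := isGramian_iff.1 h
  ext i j
  rw [Matrix.transpose_apply, integral_matrix_apply hi, integral_matrix_apply hi]
  refine setIntegral_congr_fun measurableSet_Ioi fun t ht => ?_
  simpa using (posSemidef_flow A N γ hK (le_of_lt ht)).isHermitian.apply i j

end assembly

/-- Symmetry of `Pe` merges the two cross terms into the factor `2`. -/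
theorem trace_errorSystem {m p q : ℕ} {ι κ : Type} [Fintype ι] [DecidableEq ι] [Fintype κ]
    [DecidableEq κ] (sys : HomSystem m p q ι) (red : HomSystem m p q κ)
    {Pe : Matrix (ι ⊕ κ) (ι ⊕ κ) ℝ} (hPe : Peᵀ = Pe) :
    ((sys.errorSystem red).C * Pe * (sys.errorSystem red).Cᵀ).trace =
      (sys.C * Pe.toBlocks₁₁ * sys.Cᵀ).trace - 2 * (sys.C * Pe.toBlocks₁₂ * red.Cᵀ).trace +
        (red.C * Pe.toBlocks₂₂ * red.Cᵀ).trace := by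
  have h21 : Pe.toBlocks₂₁ = Pe.toBlocks₁₂ᵀ := by
    ext i j
    exact congrFun₂ hPe.symm (Sum.inr i) (Sum.inl j)
  have h : (red.C * Pe.toBlocks₁₂ᵀ * sys.Cᵀ).trace = (sys.C * Pe.toBlocks₁₂ * red.Cᵀ).trace := by
    rw [← Matrix.trace_transpose]
    simp [Matrix.transpose_mul, Matrix.mul_assoc]
  conv_lhs => rw [← Pe.fromBlocks_toBlocks]
  simp only [HomSystem.errorSystem, Matrix.fromCols_mul_fromBlocks, Matrix.transpose_fromCols,
    Matrix.fromCols_mul_fromRows, h21, Matrix.add_mul, Matrix.trace_add, Matrix.transpose_neg,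
    Matrix.neg_mul, Matrix.mul_neg, Matrix.trace_neg, h]
  ring

/-! ### Existence of the reduced Gramian and of the mixed solution -/

section reduction

variable {m p q r s : ℕ} {bal : HomSystem m p q (Fin r ⊕ Fin s)} {γ : ℝ} {θ₁ : Fin r → ℝ}
  {θ₂ : Fin s → ℝ}

theorem toBlocks₁₁_mul_diagonal_mul (A B : Matrix (Fin r ⊕ Fin s) (Fin r ⊕ Fin s) ℝ) :
    (A * Matrix.diagonal (Sum.elim θ₁ θ₂) * Bᵀ).toBlocks₁₁ =
      A.toBlocks₁₁ * Matrix.diagonal θ₁ * B.toBlocks₁₁ᵀ +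
        A.toBlocks₁₂ * Matrix.diagonal θ₂ * B.toBlocks₁₂ᵀ := by
  conv_lhs => rw [← A.fromBlocks_toBlocks, ← B.fromBlocks_toBlocks, ← Matrix.fromBlocks_diagonal]
  simp only [Matrix.fromBlocks_multiply, Matrix.fromBlocks_transpose,
    Matrix.toBlocks_fromBlocks₁₁, Matrix.mul_zero, add_zero, zero_add]

/-- The leading block of the Lyapunov equation of the balanced system. -/
theorem HomSystem.lyapOp_toBlocks₁₁
    (hP : lyapOp bal.A bal.N γ (Matrix.diagonal (Sum.elim θ₁ θ₂)) = -(bal.X₀ * bal.X₀ᵀ)) :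
    lyapOp bal.A.toBlocks₁₁ (fun k => (bal.N k).toBlocks₁₁) γ (Matrix.diagonal θ₁) =
      -(bal.X₀.toRows₁ * bal.X₀.toRows₁ᵀ + (1 / γ ^ 2) •
        ∑ k, (bal.N k).toBlocks₁₂ * Matrix.diagonal θ₂ * (bal.N k).toBlocks₁₂ᵀ) := by
  have h := congrArg Matrix.toBlocks₁₁ hP
  have o11 : (1 : Matrix (Fin r ⊕ Fin s) (Fin r ⊕ Fin s) ℝ).toBlocks₁₁ = 1 := by
    rw [← Matrix.fromBlocks_one, Matrix.toBlocks_fromBlocks₁₁]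
  have o12 : (1 : Matrix (Fin r ⊕ Fin s) (Fin r ⊕ Fin s) ℝ).toBlocks₁₂ = 0 := by
    rw [← Matrix.fromBlocks_one, Matrix.toBlocks_fromBlocks₁₂]
  have e1 : (bal.A * Matrix.diagonal (Sum.elim θ₁ θ₂)).toBlocks₁₁ =
      bal.A.toBlocks₁₁ * Matrix.diagonal θ₁ := by
    simpa [o11, o12] using toBlocks₁₁_mul_diagonal_mul (θ₁ := θ₁) (θ₂ := θ₂) bal.A 1
  have e2 : (Matrix.diagonal (Sum.elim θ₁ θ₂) * bal.Aᵀ).toBlocks₁₁ =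
      Matrix.diagonal θ₁ * bal.A.toBlocks₁₁ᵀ := by
    simpa [o11, o12] using toBlocks₁₁_mul_diagonal_mul (θ₁ := θ₁) (θ₂ := θ₂) 1 bal.A
  have e3 : (bal.X₀ * bal.X₀ᵀ).toBlocks₁₁ = bal.X₀.toRows₁ * bal.X₀.toRows₁ᵀ := rfl
  have hadd : ∀ X Y : Matrix (Fin r ⊕ Fin s) (Fin r ⊕ Fin s) ℝ,
      (X + Y).toBlocks₁₁ = X.toBlocks₁₁ + Y.toBlocks₁₁ := fun _ _ => rfl
  have hsmul : ∀ (c : ℝ) (X : Matrix (Fin r ⊕ Fin s) (Fin r ⊕ Fin s) ℝ),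
      (c • X).toBlocks₁₁ = c • X.toBlocks₁₁ := fun _ _ => rfl
  have hneg : ∀ X : Matrix (Fin r ⊕ Fin s) (Fin r ⊕ Fin s) ℝ,
      (-X).toBlocks₁₁ = -X.toBlocks₁₁ := fun _ => rfl
  have hsum : ∀ X : Fin m → Matrix (Fin r ⊕ Fin s) (Fin r ⊕ Fin s) ℝ,
      (∑ k, X k).toBlocks₁₁ = ∑ k, (X k).toBlocks₁₁ := fun X => by
    ext i j
    simp [Matrix.toBlocks₁₁, Matrix.sum_apply]
  rw [hneg, e3] at h
  simp only [lyapOp, sylvOp, hadd, hsmul, hsum, e1, e2, toBlocks₁₁_mul_diagonal_mul,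
    Finset.sum_add_distrib, smul_add] at h ⊢
  rw [neg_add, ← h]
  abel

/-- In the leading block of the Lyapunov equation, the discarded states only add the positive
semidefinite source `γ⁻² ∑ Nₖ,₁₂ Θ₂ Nₖ,₁₂ᵀ`; so `Θ₁` dominates the integral of the reduced flow. -/
theorem HomSystem.reduced_bt_isGramianP (hθ₁ : ∀ i, 0 ≤ θ₁ i) (hθ₂ : ∀ i, 0 ≤ θ₂ i)
    (hP : lyapOp bal.A bal.N γ (Matrix.diagonal (Sum.elim θ₁ θ₂)) = -(bal.X₀ * bal.X₀ᵀ)) :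
    ∃ Pr, (bal.reduced .bt).IsGramianP γ Pr := by
  refine ⟨_, isGramian_iff.2 ⟨?_, rfl⟩⟩
  refine integrableOn_flow_of_lyapOp _ _ γ (posSemidef_mul_transpose _)
    (R := (1 / γ ^ 2) • ∑ k, (bal.N k).toBlocks₁₂ * Matrix.diagonal θ₂ * (bal.N k).toBlocks₁₂ᵀ)
    (D := Matrix.diagonal θ₁) ?_ (Matrix.PosSemidef.diagonal hθ₁) (HomSystem.lyapOp_toBlocks₁₁ hP)
  exact Matrix.PosSemidef.smul (Matrix.posSemidef_sum _ fun k _ =>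
    posSemidef_mul_mul_transpose (Matrix.PosSemidef.diagonal hθ₂) _) (by positivity)

/-- By duality the operator acts on `Θ₁`, where the compressed adjoint equation gives a negative
semidefinite result. Together with `Θ₁ > 0` this bounds the reduced flow for both methods. -/
theorem HomSystem.trace_diagonal_mul_lyapOp_reduced_nonpos {μ : Method}
    (hspa : μ = Method.spa → IsUnit bal.A.toBlocks₂₂) (hθ₂ : ∀ i, 0 ≤ θ₂ i)
    (hQ : lyapOp bal.Aᵀ (fun k => (bal.N k)ᵀ) γ (Matrix.diagonal (Sum.elim θ₁ θ₂)) =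
      -(bal.Cᵀ * bal.C)) {Z : Matrix (Fin r) (Fin r) ℝ} (hZ : Z.PosSemidef) :
    (Matrix.diagonal θ₁ * lyapOp (bal.reduced μ).A (bal.reduced μ).N γ Z).trace ≤ 0 := by
  rw [← trace_lyapOp_mul, HomSystem.reduced_adjoint_lyapOp hspa hQ]
  have h1 : 0 ≤ ((bal.reduced μ).Cᵀ * (bal.reduced μ).C * Z).trace := by
    rw [Matrix.mul_assoc, Matrix.trace_mul_comm]
    exact (posSemidef_mul_mul_transpose hZ _).trace_nonneg
  have h2 : ∀ k, 0 ≤ ((bal.boldN k μ)ᵀ * Matrix.diagonal θ₂ * bal.boldN k μ * Z).trace := by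
    intro k
    rw [Matrix.mul_assoc, Matrix.mul_assoc, Matrix.trace_mul_comm, Matrix.mul_assoc, Matrix.trace]
    refine Finset.sum_nonneg fun i _ => ?_
    rw [Matrix.diag_apply, Matrix.diagonal_mul]
    exact mul_nonneg (hθ₂ i) (posSemidef_mul_mul_transpose hZ _).diag_nonneg
  simp only [Matrix.sub_mul, Matrix.neg_mul, Matrix.smul_mul, Matrix.sum_mul, Matrix.trace_sub,
    Matrix.trace_neg, Matrix.trace_smul, Matrix.trace_sum, smul_eq_mul]
  have h3 := Finset.sum_nonneg fun k (_ : k ∈ Finset.univ) => h2 k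
  have h4 : 0 ≤ 1 / γ ^ 2 := by positivity
  nlinarith [mul_nonneg h4 h3]

theorem HomSystem.tendsto_flow_transform {n : ℕ} {sys : HomSystem m p q (Fin n)}
    (hstab : sys.IsStable γ) {S : Matrix (Fin r ⊕ Fin s) (Fin n) ℝ}
    {T : Matrix (Fin n) (Fin r ⊕ Fin s) ℝ} (hST : S * T = 1) (hTS : T * S = 1)
    (Z : Matrix (Fin r ⊕ Fin s) (Fin r ⊕ Fin s) ℝ) (i j : Fin r ⊕ Fin s) :
    Tendsto (fun n : ℕ => flow (lyapCLM (sys.transform S T).A (sys.transform S T).N γ) n Z i j)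
      atTop (𝓝 0) := by
  have hS : ∀ B : Matrix (Fin n) (Fin n) ℝ, S * B = S * B * T * S := fun B => by
    rw [Matrix.mul_assoc _ T, hTS, Matrix.mul_one]
  have hZ : S * (T * Z * Tᵀ) * Sᵀ = Z := by
    have h : Tᵀ * Sᵀ = 1 := by rw [← Matrix.transpose_mul, hST, Matrix.transpose_one]
    rw [← Matrix.mul_assoc, ← Matrix.mul_assoc, hST, Matrix.one_mul, Matrix.mul_assoc, h,
      Matrix.mul_one]
  have he : ∀ t, flow (lyapCLM (sys.transform S T).A (sys.transform S T).N γ) t Z =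
      S * flow (lyapCLM sys.A sys.N γ) t (T * Z * Tᵀ) * Sᵀ := fun t => by
    have := flow_semiconj (hS sys.A) (fun k => hS (sys.N k)) (hS sys.A) (fun k => hS (sys.N k)) γ t
      (T * Z * Tᵀ)
    rw [hZ] at this
    exact this.symm
  simp_rw [he, Matrix.mul_apply]
  rw [show (0 : ℝ) = ∑ b, (∑ a, S i a * 0) * Sᵀ b j by simp]
  exact tendsto_finsetSum _ fun b _ => (tendsto_finsetSum _ fun a _ =>
    (tendsto_flow_of_isStable sys hstab (T * Z * Tᵀ) a b).const_mul _).mul_const _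

theorem HomSystem.existsUnique_isMixedSol {n : ℕ} {sys : HomSystem m p q (Fin n)}
    (hstab : sys.IsStable γ) {S : Matrix (Fin r ⊕ Fin s) (Fin n) ℝ}
    {T : Matrix (Fin n) (Fin r ⊕ Fin s) ℝ} (hST : S * T = 1) (hTS : T * S = 1)
    (hb : bal = sys.transform S T) {μ : Method}
    (hspa : μ = Method.spa → IsUnit bal.A.toBlocks₂₂) (hθ₁ : ∀ i, 0 < θ₁ i) (hθ₂ : ∀ i, 0 ≤ θ₂ i)
    (hQ : lyapOp bal.Aᵀ (fun k => (bal.N k)ᵀ) γ (Matrix.diagonal (Sum.elim θ₁ θ₂)) =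
      -(bal.Cᵀ * bal.C)) : ∃! Y, bal.IsMixedSol μ γ Y := by
  refine existsUnique_sylvOp_eq (fun Y => sylvOp_injective ?_ fun Z hZ j => ?_) _
  · subst hb
    exact HomSystem.tendsto_flow_transform hstab hST hTS
  · exact ⟨_, fun t ht => flow_diag_le_of_trace _ _ γ hθ₁ (fun X hX =>
      HomSystem.trace_diagonal_mul_lyapOp_reduced_nonpos hspa hθ₂ hQ hX) hZ ht j⟩

end reduction

theorem HomSystem.reduced_N_eq_zero {m p q r s : ℕ} (bal : HomSystem m p q (Fin r ⊕ Fin s))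
    (μ : Method) {k : Fin m} (h : bal.N k = 0) : (bal.reduced μ).N k = 0 := by
  have h11 : (0 : Matrix (Fin r ⊕ Fin s) (Fin r ⊕ Fin s) ℝ).toBlocks₁₁ = 0 := rfl
  have h12 : (0 : Matrix (Fin r ⊕ Fin s) (Fin r ⊕ Fin s) ℝ).toBlocks₁₂ = 0 := rfl
  cases μ <;> simp [HomSystem.reduced, h, h11, h12]

end BilinearMOR

end

/-! ### The error bound -/

theorem theorem4p3 {m p q n r s : ℕ}
    (sys : BilinearMOR.HomSystem m p q (Fin n)) (γ : ℝ) (hγ : 0 < γ) (hstab : sys.IsStable γ)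
    (S : Matrix (Fin r ⊕ Fin s) (Fin n) ℝ) (T : Matrix (Fin n) (Fin r ⊕ Fin s) ℝ)
    (θ₁ : Fin r → ℝ) (θ₂ : Fin s → ℝ)
    (hbal : sys.IsBalancing γ S T (Sum.elim θ₁ θ₂)) (hθ₁ : ∀ i, 0 < θ₁ i)
    (bal : BilinearMOR.HomSystem m p q (Fin r ⊕ Fin s)) (hb : bal = sys.transform S T)
    (μ : BilinearMOR.Method)
    (hspa : μ = BilinearMOR.Method.spa →
      IsUnit bal.A.toBlocks₂₂ ∧ ∃ Pr, (bal.reduced μ).IsGramianP γ Pr) :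
    (∃! Pr, (bal.reduced μ).IsGramianP γ Pr) ∧
    (∃! Y, bal.IsMixedSol μ γ Y) ∧
    ∀ Pr Y, (bal.reduced μ).IsGramianP γ Pr → bal.IsMixedSol μ γ Y →
      0 ≤ (Matrix.diagonal θ₂ * bal.weight μ γ Pr Y).trace ∧
      ∀ (u : ℝ → EuclideanSpace ℝ (Fin m)) (v₀ : EuclideanSpace ℝ (Fin q))
        (y yr : ℝ → EuclideanSpace ℝ (Fin p)),
        BilinearMOR.IsL2 u → sys.IsOutput u v₀ y → (bal.reduced μ).IsOutput u v₀ yr →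
        BilinearMOR.IsL2 (fun t => y t - yr t) ∧
        BilinearMOR.l2Norm (fun t => y t - yr t) ≤
          Real.sqrt (Matrix.diagonal θ₂ * bal.weight μ γ Pr Y).trace *
            Real.exp (1 / 2 * BilinearMOR.l2Norm (fun t => γ • sys.effControl u t) ^ 2) *
            ‖v₀‖ := by
  obtain ⟨hST, hTS, P₀, Q, hP₀, hQ, hSP, hTQ⟩ := hbal
  have hGP : bal.IsGramianP γ (Matrix.diagonal (Sum.elim θ₁ θ₂)) := by
    rw [hb, ← hSP]; exact hP₀.transform hTS
  have hGQ : bal.IsGramianQ γ (Matrix.diagonal (Sum.elim θ₁ θ₂)) := by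
    rw [hb, ← hTQ]; exact hQ.transform hTS
  have hP := hGP.lyapOp_eq
  have hQ' := hGQ.lyapOp_eq
  -- Nonnegativity of `Θ₂` is inherited from the diagonal of a Gramian.
  have hθ₂ : ∀ i, 0 ≤ θ₂ i := fun i => by
    simpa using BilinearMOR.IsGramian.diag_nonneg hGP
      (BilinearMOR.posSemidef_mul_transpose bal.X₀) (Sum.inr i)
  have hunit : μ = BilinearMOR.Method.spa → IsUnit bal.A.toBlocks₂₂ := fun h => (hspa h).1
  have hPr : ∃ Pr, (bal.reduced μ).IsGramianP γ Pr := by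
    cases μ with
    | bt => exact BilinearMOR.HomSystem.reduced_bt_isGramianP (fun i => (hθ₁ i).le) hθ₂ hP
    | spa => exact (hspa rfl).2
  have hY : ∃! Y, bal.IsMixedSol μ γ Y :=
    BilinearMOR.HomSystem.existsUnique_isMixedSol hstab hST hTS hb hunit hθ₁ hθ₂ hQ'
  refine ⟨hPr.elim fun Pr h => BilinearMOR.IsGramian.existsUnique h, hY, fun Pr Y hPr hYsol => ?_⟩
  obtain ⟨Pe, hPe, h11, h22, h12⟩ := hGP.errorSystem hPr
  rw [bal.reduced_X₀] at h12
  -- Uniqueness identifies the algebraic solution `Y` with the integral of the mixed flow.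
  have hYe : Pe.toBlocks₁₂ = Y := hY.unique h12 hYsol
  have htrace : ((bal.errorSystem (bal.reduced μ)).C * Pe *
      (bal.errorSystem (bal.reduced μ)).Cᵀ).trace =
        (Matrix.diagonal θ₂ * bal.weight μ γ Pr Y).trace := by
    rw [BilinearMOR.trace_errorSystem _ _ (BilinearMOR.IsGramian.transpose_eq hPe
      (BilinearMOR.posSemidef_mul_transpose _)), h11, h22, hYe]
    exact BilinearMOR.HomSystem.trace_error_eq hunit hP hQ' hPr.lyapOp_eq hYsol
  rw [← htrace]
  refine ⟨hPe.trace_nonneg, fun u v₀ y yr hu hy hyr => ?_⟩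
  have hy' : bal.IsOutput u v₀ y := by rw [hb]; exact hy.transform hu hTS
  -- Where `N k = 0`, the bilinear coefficient of the error system vanishes too, so the error output
  -- is unchanged when this control is set to zero.
  have heff : (bal.errorSystem (bal.reduced μ)).IsOutput (sys.effControl u) v₀
      (fun t => y t - yr t) := by
    refine (hy'.sub hu hyr).congr_control fun t k => ?_
    by_cases hk : sys.N k = 0
    · have h1 : bal.N k = 0 := by rw [hb]; simp [BilinearMOR.HomSystem.transform, hk]
      have h2 : (bal.errorSystem (bal.reduced μ)).N k = 0 := by
        simp [BilinearMOR.HomSystem.errorSystem, h1, bal.reduced_N_eq_zero μ h1]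
      rw [h2, smul_zero, smul_zero]
    · simp [BilinearMOR.HomSystem.effControl, hk]
  exact heff.l2Norm_le hγ (hu.effControl sys) hPe
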